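/- **Setting.** An *isometric embedding* is a distance-preserving map. An *extended metric* may take the value $\infty$. $d_H$ is the Hausdorff distance between subsets of a metric space (with $d_H(\emptyset,\emptyset)=0$ and $d_H(\emptyset,A)=\infty$ for $A\ne\emptyset$). A metric space is *boundedly compact* if all its closed balls are compact; $\overline B_r(o)$ is the closed ball. (a) Let $\tau$ be a functor from the category of compact metric spaces (including the empty one), with isometric embeddings as morphisms, to the category whose objects are extended metric spaces $A$ with a partial order such that $\{a'\in A: a'\le a\}$ is compact for every $a\in A$, and whose morphisms are the order-preserving isometric embeddings. So $f:X\to Y$ gives $\tau_f:\tau(X)\to\tau(Y)$. Assume that if $f:X\to X$ is an isometry of $X$ onto itself, $a\in\tau(X)$ and $\tau_f(a)\le a$, then $\tau_f(a)=a$. (b) Let $\tau^t$ be a contravariant functor from compact metric spaces to posets with $\tau^t(X)=\tau(X)$ as posets, so that $f:X\to Y$ gives an order-preserving $\tau^t_f:\tau(Y)\to\tau(X)$, such that $\tau^t_f(\tau_f(a))=a$ and $\tau_f(\tau^t_f(b))\le b$ for all $f:X\to Y$, $a\in\tau(X)$, $b\in\tau(Y)$. (c) For a boundedly-compact $X$,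 let $\varphi(X)$ be the set of families $a=(a_K)_K$, indexed by the compact subsets $K$ of $X$, with $a_K\in\tau(K)$ and $\tau^t_\iota(a_L)=a_K$ whenever $\iota:K\hookrightarrow L$ is an inclusion of compact subsets. Let $\mathcal C'$ be the set of isomorphism classes of tuples $\mathcal X=(X,o;a)$ with $X$ boundedly compact, $o\in X$, $a\in\varphi(X)$; an isomorphism $(X,o;a)\to(X',o';a')$ is a surjective isometric embedding $e:X\to X'$ with $e(o)=o'$ and $\tau_{e|_K}(a_K)=a'_{e(K)}$ for all compact $K\subseteq X$. If $X$ is compact, $a\in\tau(X)$ is identified with the family $(\tau^t_{K\hookrightarrow X}(a))_K\in\varphi(X)$. (d) For tuples $(X,o_X;a)$, $(Y,o_Y;b)$ with $X,Y$ compact, $a\in\tau(X)$, $b\in\tau(Y)$, let $$d^c\big((X,o_X;a),(Y,o_Y;b)\big)=\inf_{Z,f,g}\ \max\{d_H(f(X),g(Y)),\ d(f(o_X),g(o_Y)),\ d(\tau_f(a),\tau_g(b))\},$$ the infimum being over all compact metric spaces $Z$ and isometric embeddings $f:X\to Z$, $g:Y\to Z$. (e) For a tuple $\mathcal X=(X,o;a)$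 and $r\ge 0$, let $\mathcal X^{(r)}=(\overline B_r(o),o;a_{\overline B_r(o)})$. For a compact $K\subseteq X$ containing $o$ and $a'\in\tau(K)$, write $(K,o;a')\preceq\mathcal X$ if $a'\le a_K$; in particular, for such tuples on compact subsets $K\subseteq L$, $(K,o;a')\preceq(L,o;a'')$ means $a'\le\tau^t_{K\hookrightarrow L}(a'')$. For $0<\epsilon\le 1$ let $$a_\epsilon(\mathcal X,\mathcal Y)=\inf\{d^c(\mathcal X^{(1/\epsilon)},\mathcal Y')\ :\ \mathcal Y^{(1/\epsilon-\epsilon)}\preceq\mathcal Y'\preceq\mathcal Y\},$$ where $\mathcal Y'$ has a compact underlying space, and define the distance on $\mathcal C'$ by $$d(\mathcal X,\mathcal Y)=\inf\{\epsilon\in(0,1]:\ \max(a_\epsilon(\mathcal X,\mathcal Y),a_\epsilon(\mathcal Y,\mathcal X))<\epsilon/2\},\qquad \inf\emptyset:=1 .$$ **Assumptions.** 1. For all tuples $\mathcal X,\mathcal Y$ with compact underlying spaces and every $\mathcal X'\preceq\mathcal X$ there is $\mathcal Y'\preceq\mathcal Y$ with $d^c(\mathcal X',\mathcal Y')\le d^c(\mathcal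 X,\mathcal Y)$. 2. If moreover $\epsilon:=d^c(\mathcal X,\mathcal Y)<\infty$, $r\ge 2\epsilon$ and $\mathcal X^{(r)}\preceq\mathcal X'\preceq\mathcal X$, then $\mathcal Y'$ in 1 can be chosen with $\mathcal Y^{(r-2\epsilon)}\preceq\mathcal Y'\preceq\mathcal Y$. 3. If $Z,X,X_1,X_2,\dots$ are compact metric spaces, $f:X\to Z$ and $f_n:X_n\to Z$ are isometric embeddings with $d_H(f_n(X_n),f(X))\to0$, and $a_n\in\tau(X_n)$, $b\in\tau(Z)$ satisfy $\tau_{f_n}(a_n)\to b$, then $b\in\operatorname{Im}(\tau_f)$. 4. $\tau$ is pointwise-continuous: if isometric embeddings $f_n:X\to Y$ of compact metric spaces converge pointwise to an isometric embedding $f$, then $\tau_{f_n}\to\tau_f$ pointwise. 5. $\tau$ is Hausdorff-continuous: in the situation of 3 (without $a_n$, $b$), $d_H(\operatorname{Im}\tau_{f_n},\operatorname{Im}\tau_f)\to0$. **Theorem.** Under these assumptions: (i) if $\tau(X)$ is complete for every compact metric space $X$, then $(\mathcal C',d)$ is complete, i.e. every $d$-Cauchy sequence in $\mathcal C'$ converges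 with respect to $d$; (ii) if $\tau(X)$ is separable for every compact metric space $X$, then $(\mathcal C',d)$ is separable, i.e. $\mathcal C'$ has a countable subset that is dense with respect to $d$. -/

import Mathlib

open scoped NNReal ENNReal
open Filter Topology TopologicalSpace

universe u v

namespace GHF

/-- A functor from the category of compact metric spaces (morphisms: isometric embeddings) to the
category of extended metric spaces (morphisms: isometric embeddings). -/
structure MetricFunctor where
  obj : (X : Type u) → [MetricSpace X] → [CompactSpace X] → Type v
  [emetric : ∀ (X : Type u) [MetricSpace X] [CompactSpace X], EMetricSpace (obj X)]
  map : ∀ {X Y : Type u} [MetricSpace X] [CompactSpace X] [MetricSpace Y] [CompactSpace Y]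
    (f : X → Y), Isometry f → obj X → obj Y
  isometry_map : ∀ {X Y : Type u} [MetricSpace X] [CompactSpace X] [MetricSpace Y]
    [CompactSpace Y] (f : X → Y) (hf : Isometry f), Isometry (map f hf)
  map_id : ∀ {X : Type u} [MetricSpace X] [CompactSpace X] (a : obj X),
    map (id : X → X) isometry_id a = a
  map_comp : ∀ {X Y Z : Type u} [MetricSpace X] [CompactSpace X] [MetricSpace Y] [CompactSpace Y]
    [MetricSpace Z] [CompactSpace Z] (f : X → Y) (hf : Isometry f) (g : Y → Z) (hg : Isometry g)
    (a : obj X), map (g ∘ f) (hg.comp hf) a = map g hg (map f hf a)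

attribute [instance] MetricFunctor.emetric

namespace MetricFunctor

variable (τ : MetricFunctor.{u, v})

/-- If `f n → f` pointwise, then `τ (f n) → τ f` pointwise. -/
def PointwiseContinuous : Prop :=
  ∀ (X Y : Type u) [MetricSpace X] [CompactSpace X] [MetricSpace Y] [CompactSpace Y]
    (f : X → Y) (hf : Isometry f) (fn : ℕ → X → Y) (hfn : ∀ n, Isometry (fn n)),
    (∀ x, Tendsto (fun n => fn n x) atTop (𝓝 (f x))) →
    ∀ a : τ.obj X, Tendsto (fun n => τ.map (fn n) (hfn n) a) atTop (𝓝 (τ.map f hf a))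

/-- If `Im (f n) → Im f` in the Hausdorff distance, then `Im (τ (f n)) → Im (τ f)` in the
Hausdorff distance. -/
def HausdorffContinuous : Prop :=
  ∀ (Z X : Type u) [MetricSpace Z] [CompactSpace Z] [MetricSpace X] [CompactSpace X]
    (Xn : ℕ → Type u) [∀ n, MetricSpace (Xn n)] [∀ n, CompactSpace (Xn n)]
    (f : X → Z) (hf : Isometry f) (fn : ∀ n, Xn n → Z) (hfn : ∀ n, Isometry (fn n)),
    Tendsto (fun n => Metric.hausdorffEDist (Set.range (fn n)) (Set.range f)) atTop (𝓝 0) →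
    Tendsto (fun n => Metric.hausdorffEDist (Set.range (τ.map (fn n) (hfn n)))
      (Set.range (τ.map f hf))) atTop (𝓝 0)

/-- If `Im (f n) → Im f` in the Hausdorff distance and `τ (f n) (a n) → b`, then
`b ∈ Im (τ f)`. -/
def ImageClosed : Prop :=
  ∀ (Z X : Type u) [MetricSpace Z] [CompactSpace Z] [MetricSpace X] [CompactSpace X]
    (Xn : ℕ → Type u) [∀ n, MetricSpace (Xn n)] [∀ n, CompactSpace (Xn n)]
    (f : X → Z) (hf : Isometry f) (fn : ∀ n, Xn n → Z) (hfn : ∀ n, Isometry (fn n)),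
    Tendsto (fun n => Metric.hausdorffEDist (Set.range (fn n)) (Set.range f)) atTop (𝓝 0) →
    ∀ (b : τ.obj Z) (a : ∀ n, τ.obj (Xn n)),
      Tendsto (fun n => τ.map (fn n) (hfn n) (a n)) atTop (𝓝 b) → b ∈ Set.range (τ.map f hf)

/-- The Gromov-Hausdorff-functor distance between `(X, a)` and `(Y, b)`: the infimum, over all
compact metric spaces `Z` and isometric embeddings `f : X → Z`, `g : Y → Z`, of
`d_H (f X, g Y) ∨ d (τ f a, τ g b)`. -/
noncomputable def ghf {X Y : Type u} [MetricSpace X] [CompactSpace X] [MetricSpace Y]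
    [CompactSpace Y] (a : τ.obj X) (b : τ.obj Y) : ℝ≥0∞ :=
  ⨅ (Z : Type u) (_ : MetricSpace Z) (_ : CompactSpace Z) (f : X → Z) (hf : Isometry f)
    (g : Y → Z) (hg : Isometry g),
    max (Metric.hausdorffEDist (Set.range f) (Set.range g)) (edist (τ.map f hf a) (τ.map g hg b))

/-- The functor `X ↦ X × τ X`, with the max product metric. -/
def pointed : MetricFunctor.{u, max u v} where
  obj X _ _ := X × τ.obj X
  emetric X _ _ := Prod.emetricSpaceMax
  map f hf := Prod.map f (τ.map f hf)
  isometry_map f hf := hf.prodMap (τ.isometry_map f hf)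
  map_id a := by simp [Prod.map, τ.map_id]
  map_comp f hf g hg a := by simp [Prod.map, τ.map_comp f hf g hg]

end MetricFunctor

/-- A functor from compact metric spaces to the category of extended metric spaces carrying a
partial order with compact cones `{a' | a' ≤ a}`; the morphisms of the latter category are the
order-preserving isometric embeddings. -/
structure PosFunctor extends MetricFunctor.{u, v} where
  [order : ∀ (X : Type u) [MetricSpace X] [CompactSpace X], PartialOrder (obj X)]
  isCompact_cone : ∀ {X : Type u} [MetricSpace X] [CompactSpace X] (a : obj X),
    IsCompact {a' : obj X | a' ≤ a}
  monotone_map : ∀ {X Y : Type u} [MetricSpace X] [CompactSpace X] [MetricSpace Y]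
    [CompactSpace Y] (f : X → Y) (hf : Isometry f), Monotone (map f hf)

attribute [instance] PosFunctor.order

/-- For every isometry `f` of a compact space onto itself, `τ f a ≤ a` only if `τ f a = a`. -/
def PosFunctor.NoShrinking (τ : PosFunctor.{u, v}) : Prop :=
  ∀ (X : Type u) [MetricSpace X] [CompactSpace X] (f : X ≃ᵢ X) (a : τ.obj X),
    τ.map f f.isometry a ≤ a → τ.map f f.isometry a = a

/-- A truncation functor for `τ`: a contravariant functor to posets with the same objects. -/
structure Truncation (τ : PosFunctor.{u, v}) where
  trunc : ∀ {X Y : Type u} [MetricSpace X] [CompactSpace X] [MetricSpace Y] [CompactSpace Y]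
    (f : X → Y), Isometry f → τ.obj Y → τ.obj X
  monotone_trunc : ∀ {X Y : Type u} [MetricSpace X] [CompactSpace X] [MetricSpace Y]
    [CompactSpace Y] (f : X → Y) (hf : Isometry f), Monotone (trunc f hf)
  trunc_id : ∀ {X : Type u} [MetricSpace X] [CompactSpace X] (a : τ.obj X),
    trunc (id : X → X) isometry_id a = a
  trunc_comp : ∀ {X Y Z : Type u} [MetricSpace X] [CompactSpace X] [MetricSpace Y]
    [CompactSpace Y] [MetricSpace Z] [CompactSpace Z] (f : X → Y) (hf : Isometry f) (g : Y → Z)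
    (hg : Isometry g) (c : τ.obj Z), trunc (g ∘ f) (hg.comp hf) c = trunc f hf (trunc g hg c)
  trunc_map : ∀ {X Y : Type u} [MetricSpace X] [CompactSpace X] [MetricSpace Y] [CompactSpace Y]
    (f : X → Y) (hf : Isometry f) (a : τ.obj X), trunc f hf (τ.map f hf a) = a
  map_trunc_le : ∀ {X Y : Type u} [MetricSpace X] [CompactSpace X] [MetricSpace Y]
    [CompactSpace Y] (f : X → Y) (hf : Isometry f) (b : τ.obj Y), τ.map f hf (trunc f hf b) ≤ b

/-- The inclusion map of compact subsets `K ⊆ L`. -/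
def incl {X : Type u} [MetricSpace X] {K L : Compacts X} (h : K ≤ L) : K → L :=
  fun x => ⟨x.1, h x.2⟩

theorem isometry_incl {X : Type u} [MetricSpace X] {K L : Compacts X} (h : K ≤ L) :
    Isometry (incl h) := fun _ _ => rfl

/-- The restriction `K → K'` of an isometry `e` with `e(K) = K'`. -/
def restr {X Y : Type u} [MetricSpace X] [MetricSpace Y] (e : X ≃ᵢ Y) {K : Compacts X}
    {K' : Compacts Y} (h : (K' : Set Y) = e '' K) : K → K' :=
  fun x => ⟨e x.1, by
    rw [← SetLike.mem_coe, h]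
    exact Set.mem_image_of_mem e x.2⟩

theorem isometry_restr {X Y : Type u} [MetricSpace X] [MetricSpace Y] (e : X ≃ᵢ Y)
    {K : Compacts X} {K' : Compacts Y} (h : (K' : Set Y) = e '' K) : Isometry (restr e h) :=
  fun x y => e.isometry x.1 y.1

/-- The compact closed ball of radius `r` in a boundedly-compact space. -/
def cball {X : Type u} [MetricSpace X] [ProperSpace X] (o : X) (r : ℝ≥0) : Compacts X :=
  ⟨Metric.closedBall o r, isCompact_closedBall o r⟩

theorem mem_cball_self {X : Type u} [MetricSpace X] [ProperSpace X] (o : X) (r : ℝ≥0) :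
    o ∈ cball o r := Metric.mem_closedBall_self r.2

section Spaces

variable {τ : PosFunctor.{u, v}} (T : Truncation τ)

/-- The extension `φ(X)` of `τ` to boundedly-compact `X`: families `a_K ∈ τ(K)`, indexed by the
compact subsets `K` of `X`, that are compatible with truncation. -/
structure Phi (X : Type u) [MetricSpace X] where
  val : ∀ K : Compacts X, τ.obj K
  compat : ∀ (K L : Compacts X) (h : K ≤ L), T.trunc (incl h) (isometry_incl h) (val L) = val K

/-- A pointed boundedly-compact metric space with an additional structure, `(X, o; a)` with
`a ∈ φ(X)`. -/
structure Tuple where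
  carrier : Type u
  [metric : MetricSpace carrier]
  [proper : ProperSpace carrier]
  origin : carrier
  str : Phi T carrier

attribute [instance] Tuple.metric Tuple.proper

/-- A pointed compact metric space with an additional structure, `(X, o; a)` with `a ∈ τ(X)`. -/
structure CompactTuple (τ : PosFunctor.{u, v}) where
  carrier : Type u
  [metric : MetricSpace carrier]
  [compact : CompactSpace carrier]
  origin : carrier
  str : τ.obj carrier

attribute [instance] CompactTuple.metric CompactTuple.compact

/-- The distance `d^c_{τ'}`, where `τ'(X) = X × τ(X)`. -/
noncomputable def dc (A B : CompactTuple τ) : ℝ≥0∞ :=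
  (MetricFunctor.pointed τ.toMetricFunctor).ghf (X := A.carrier) (Y := B.carrier)
    (A.origin, A.str) (B.origin, B.str)

/-- A compact tuple, regarded as a boundedly-compact one: `a ∈ τ(X)` is identified with the family
of its truncations to the compact subsets of `X`. -/
def CompactTuple.toTuple (A : CompactTuple τ) : Tuple T where
  carrier := A.carrier
  origin := A.origin
  str :=
    { val := fun K => T.trunc (Subtype.val : K → A.carrier) isometry_subtype_coe A.str
      compat := fun K L h =>
        (T.trunc_comp (incl h) (isometry_incl h) (Subtype.val : L → A.carrier)
          isometry_subtype_coe A.str).symm }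

variable {T}

/-- A tuple `(K, o; a)` where `K` is a compact subset of `𝒳` containing the origin of `𝒳`, which is
also the origin of `K`, and `a ∈ τ(K)` is arbitrary. -/
structure Piece (𝒳 : Tuple T) where
  carrier : Compacts 𝒳.carrier
  origin_mem : 𝒳.origin ∈ carrier
  str : τ.obj carrier

def Piece.toCompactTuple {𝒳 : Tuple T} (P : Piece 𝒳) : CompactTuple τ where
  carrier := P.carrier
  origin := ⟨𝒳.origin, P.origin_mem⟩
  str := P.str

/-- `P ≼ 𝒳`: the structure of `P` is below the truncation of that of `𝒳`. -/
def Piece.Below {𝒳 : Tuple T} (P : Piece 𝒳) : Prop := P.str ≤ 𝒳.str.val P.carrier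

/-- `P ≼ Q`, for two tuples on compact subsets of the same space. -/
def Piece.Le {𝒳 : Tuple T} (P Q : Piece 𝒳) : Prop :=
  ∃ h : P.carrier ≤ Q.carrier, P.str ≤ T.trunc (incl h) (isometry_incl h) Q.str

/-- The closed ball of radius `r` about the origin, with the truncation of the structure. -/
def Tuple.ball (𝒳 : Tuple T) (r : ℝ≥0) : Piece 𝒳 where
  carrier := cball 𝒳.origin r
  origin_mem := mem_cball_self 𝒳.origin r
  str := 𝒳.str.val (cball 𝒳.origin r)

/-- `a_ε(𝒳, 𝒴)`, the infimum of `d^c(𝒳^(1/ε), 𝒴')` over the compact tuples `𝒴'` with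
`𝒴^(1/ε - ε) ≼ 𝒴' ≼ 𝒴` (used for `0 < ε ≤ 1`, where `1/ε - ε ≥ 0`). -/
noncomputable def aFun (ε : ℝ≥0) (𝒳 𝒴 : Tuple T) : ℝ≥0∞ :=
  ⨅ (P : Piece 𝒴) (_ : (𝒴.ball (ε⁻¹ - ε)).Le P) (_ : P.Below),
    dc (𝒳.ball ε⁻¹).toCompactTuple P.toCompactTuple

/-- The infimum of the `ε ∈ (0, 1]` with `a_ε(𝒳, 𝒴) ∨ a_ε(𝒴, 𝒳) < ε / 2`, and `1` if there are
none (inserting `1` changes nothing otherwise). -/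
noncomputable def Tuple.dist (𝒳 𝒴 : Tuple T) : ℝ≥0 :=
  sInf (insert 1 {ε : ℝ≥0 | 0 < ε ∧ ε ≤ 1 ∧ max (aFun ε 𝒳 𝒴) (aFun ε 𝒴 𝒳) < (ε : ℝ≥0∞) / 2})

/-- `e` is an isomorphism of tuples: an isometry of the spaces that maps the origin to the origin
and transports the one structure to the other. -/
def Tuple.IsIso (𝒳 𝒴 : Tuple T) (e : 𝒳.carrier ≃ᵢ 𝒴.carrier) : Prop :=
  e 𝒳.origin = 𝒴.origin ∧
    ∀ (K : Compacts 𝒳.carrier) (K' : Compacts 𝒴.carrier) (h : (K' : Set 𝒴.carrier) = e '' K),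
      τ.map (restr e h) (isometry_restr e h) (𝒳.str.val K) = 𝒴.str.val K'

theorem map_congr {X Y : Type u} [MetricSpace X] [CompactSpace X] [MetricSpace Y] [CompactSpace Y]
    {f g : X → Y} (hf : Isometry f) (hg : Isometry g) (h : f = g) (a : τ.obj X) :
    τ.map f hf a = τ.map g hg a := by
  subst h; rfl

theorem map_map_eq_self {X Y : Type u} [MetricSpace X] [CompactSpace X] [MetricSpace Y]
    [CompactSpace Y] {f : X → Y} {g : Y → X} (hf : Isometry f) (hg : Isometry g)
    (h : ∀ x, g (f x) = x) (a : τ.obj X) : τ.map g hg (τ.map f hf a) = a := by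
  rw [← τ.map_comp, map_congr (hg.comp hf) isometry_id (funext h), τ.map_id]

theorem trunc_congr (T : Truncation τ) {X Y : Type u} [MetricSpace X] [CompactSpace X]
    [MetricSpace Y] [CompactSpace Y] {f g : X → Y} (hf : Isometry f) (hg : Isometry g) (h : f = g)
    (a : τ.obj Y) : T.trunc f hf a = T.trunc g hg a := by
  subst h; rfl

theorem map_eq_trunc (T : Truncation τ) {X Y : Type u} [MetricSpace X] [CompactSpace X]
    [MetricSpace Y] [CompactSpace Y] {f : X → Y} {g : Y → X} (hf : Isometry f) (hg : Isometry g)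
    (h : ∀ x, g (f x) = x) (a : τ.obj X) : τ.map f hf a = T.trunc g hg a := by
  conv_rhs => rw [← map_map_eq_self hf hg h a]
  rw [T.trunc_map]

theorem image_symm {X Y : Type u} [MetricSpace X] [MetricSpace Y] (e : X ≃ᵢ Y) {K : Compacts X}
    {K' : Compacts Y} (h : (K' : Set Y) = e '' K) : (K : Set X) = e.symm '' K' := by
  rw [h, Set.image_image]; simp

theorem restr_symm_restr {X Y : Type u} [MetricSpace X] [MetricSpace Y] (e : X ≃ᵢ Y)
    {K : Compacts X} {K' : Compacts Y} (h : (K' : Set Y) = e '' K)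
    (h' : (K : Set X) = e.symm '' K') (x : K) : restr e.symm h' (restr e h x) = x :=
  Subtype.ext (e.symm_apply_apply x.1)

theorem restr_restr_symm {X Y : Type u} [MetricSpace X] [MetricSpace Y] (e : X ≃ᵢ Y)
    {K : Compacts X} {K' : Compacts Y} (h : (K' : Set Y) = e '' K)
    (h' : (K : Set X) = e.symm '' K') (x : K') : restr e h (restr e.symm h' x) = x :=
  Subtype.ext (e.apply_symm_apply x.1)

/-- Truncation commutes with the restrictions of an isometry. -/
theorem trunc_map_restr (T : Truncation τ) {X Y : Type u} [MetricSpace X] [MetricSpace Y]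
    (e : X ≃ᵢ Y) {K L : Compacts X} {K' L' : Compacts Y} (hK : (K' : Set Y) = e '' K)
    (hL : (L' : Set Y) = e '' L) (h : K ≤ L) (h' : K' ≤ L') (a : τ.obj L) :
    T.trunc (incl h') (isometry_incl h') (τ.map (restr e hL) (isometry_restr e hL) a) =
      τ.map (restr e hK) (isometry_restr e hK) (T.trunc (incl h) (isometry_incl h) a) := by
  rw [map_eq_trunc T (isometry_restr e hL) (isometry_restr e.symm (image_symm e hL))
      (restr_symm_restr e hL (image_symm e hL)),
    map_eq_trunc T (isometry_restr e hK) (isometry_restr e.symm (image_symm e hK))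
      (restr_symm_restr e hK (image_symm e hK)), ← T.trunc_comp, ← T.trunc_comp]
  exact trunc_congr T _ _ rfl a

theorem Tuple.IsIso.symm {𝒳 𝒴 : Tuple T} {e : 𝒳.carrier ≃ᵢ 𝒴.carrier} (he : 𝒳.IsIso 𝒴 e) :
    𝒴.IsIso 𝒳 e.symm := by
  refine ⟨by rw [← he.1, e.symm_apply_apply], fun K K' h => ?_⟩
  have h' : (K : Set 𝒴.carrier) = e '' K' := by simpa using image_symm e.symm h
  rw [← he.2 K' K h']
  exact map_map_eq_self _ _ (restr_symm_restr e h' h) _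

theorem Tuple.isIso_refl (𝒳 : Tuple T) : 𝒳.IsIso 𝒳 (IsometryEquiv.refl _) := by
  refine ⟨rfl, fun K K' h => ?_⟩
  obtain rfl : K' = K := SetLike.coe_injective (h.trans (Set.image_id _))
  exact (map_congr _ isometry_id rfl _).trans (τ.map_id _)

theorem Tuple.IsIso.trans {𝒳 𝒴 𝒵 : Tuple T} {e : 𝒳.carrier ≃ᵢ 𝒴.carrier}
    {f : 𝒴.carrier ≃ᵢ 𝒵.carrier} (he : 𝒳.IsIso 𝒴 e) (hf : 𝒴.IsIso 𝒵 f) :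
    𝒳.IsIso 𝒵 (e.trans f) := by
  refine ⟨by simp [he.1, hf.1], fun K K' h => ?_⟩
  have h1 : ((K.map e e.continuous : Compacts 𝒴.carrier) : Set 𝒴.carrier) = e '' K := by simp
  have h2 : (K' : Set 𝒵.carrier) = f '' (K.map e e.continuous : Compacts 𝒴.carrier) := by
    rw [h1, h, Set.image_image]; rfl
  rw [← hf.2 _ _ h2, ← he.2 _ _ h1, ← τ.map_comp]
  exact map_congr _ _ rfl _

variable (T) in
/-- Isomorphism of tuples, as an equivalence relation. -/
def tupleSetoid : Setoid (Tuple T) where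
  r 𝒳 𝒴 := ∃ e, 𝒳.IsIso 𝒴 e
  iseqv :=
    { refl := fun 𝒳 => ⟨_, 𝒳.isIso_refl⟩
      symm := fun ⟨_, he⟩ => ⟨_, he.symm⟩
      trans := fun ⟨_, he⟩ ⟨_, hf⟩ => ⟨_, he.trans hf⟩ }

theorem dc_le_of_iso {A A' B B' : CompactTuple τ} (f : A.carrier → A'.carrier) (hf : Isometry f)
    (sf : Function.Surjective f) (of : f A.origin = A'.origin) (mf : τ.map f hf A.str = A'.str)
    (g : B.carrier → B'.carrier) (hg : Isometry g) (sg : Function.Surjective g)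
    (og : g B.origin = B'.origin) (mg : τ.map g hg B.str = B'.str) : dc A B ≤ dc A' B' := by
  unfold dc MetricFunctor.ghf
  refine le_iInf fun Z => le_iInf fun iM => le_iInf fun iC => le_iInf fun p => le_iInf fun hp =>
    le_iInf fun q => le_iInf fun hq => ?_
  refine iInf_le_of_le Z ?_
  refine iInf_le_of_le iM ?_
  refine iInf_le_of_le iC ?_
  refine iInf_le_of_le (p ∘ f) ?_
  refine iInf_le_of_le (hp.comp hf) ?_
  refine iInf_le_of_le (q ∘ g) ?_
  refine iInf_le_of_le (hq.comp hg) ?_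
  rw [sf.range_comp, sg.range_comp]
  have h1 : (MetricFunctor.pointed τ.toMetricFunctor).map (p ∘ f) (hp.comp hf)
      (A.origin, A.str) = (MetricFunctor.pointed τ.toMetricFunctor).map p hp (A'.origin, A'.str) :=
    Prod.ext (congrArg p of) ((τ.map_comp f hf p hp A.str).trans (congrArg _ mf))
  have h2 : (MetricFunctor.pointed τ.toMetricFunctor).map (q ∘ g) (hq.comp hg)
      (B.origin, B.str) = (MetricFunctor.pointed τ.toMetricFunctor).map q hq (B'.origin, B'.str) :=
    Prod.ext (congrArg q og) ((τ.map_comp g hg q hq B.str).trans (congrArg _ mg))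
  exact max_le_max le_rfl (le_of_eq (congrArg₂ edist h1 h2))

theorem cball_image {X Y : Type u} [MetricSpace X] [ProperSpace X] [MetricSpace Y] [ProperSpace Y]
    (e : X ≃ᵢ Y) {o : X} {o' : Y} (h : e o = o') (r : ℝ≥0) :
    (cball o' r : Set Y) = e '' (cball o r : Set X) := by
  subst h; exact (e.image_closedBall o r).symm

theorem restr_surjective {X Y : Type u} [MetricSpace X] [MetricSpace Y] (e : X ≃ᵢ Y)
    {K : Compacts X} {K' : Compacts Y} (h : (K' : Set Y) = e '' K) :
    Function.Surjective (restr e h) :=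
  fun y => ⟨_, restr_restr_symm e h (image_symm e h) y⟩

theorem aFun_le_of_iso {𝒳 𝒳' 𝒴 𝒴' : Tuple T} {i : 𝒳.carrier ≃ᵢ 𝒳'.carrier}
    {j : 𝒴.carrier ≃ᵢ 𝒴'.carrier} (hi : 𝒳.IsIso 𝒳' i) (hj : 𝒴.IsIso 𝒴' j) (ε : ℝ≥0) :
    aFun ε 𝒳 𝒴 ≤ aFun ε 𝒳' 𝒴' := by
  unfold aFun
  refine le_iInf fun P' => le_iInf fun h1 => le_iInf fun h2 => ?_
  obtain ⟨h1, h1'⟩ := h1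
  have hK : ((P'.carrier.map j.symm j.symm.continuous : Compacts 𝒴.carrier) : Set 𝒴.carrier) =
      j.symm '' P'.carrier := by simp
  have hK' : (P'.carrier : Set 𝒴'.carrier) =
      j '' (P'.carrier.map j.symm j.symm.continuous : Compacts 𝒴.carrier) := by
    simpa using image_symm j.symm hK
  let P : Piece 𝒴 :=
    { carrier := P'.carrier.map j.symm j.symm.continuous
      origin_mem := by
        rw [← SetLike.mem_coe, hK]
        exact ⟨_, P'.origin_mem, hj.symm.1⟩
      str := τ.map (restr j.symm hK) (isometry_restr j.symm hK) P'.str }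
  have hb := cball_image j.symm hj.symm.1 (ε⁻¹ - ε)
  have hle : (𝒴.ball (ε⁻¹ - ε)).carrier ≤ P.carrier := by
    rw [← SetLike.coe_subset_coe]
    change (cball 𝒴.origin (ε⁻¹ - ε) : Set 𝒴.carrier) ⊆
      (P'.carrier.map j.symm j.symm.continuous : Compacts 𝒴.carrier)
    rw [hb, hK]
    exact Set.image_mono h1
  refine iInf_le_of_le P <| iInf_le_of_le ⟨hle, ?_⟩ <| iInf_le_of_le ?_ ?_
  · change 𝒴.str.val (cball 𝒴.origin (ε⁻¹ - ε)) ≤ _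
    rw [← hj.symm.2 _ _ hb]
    refine (τ.monotone_map _ _ h1').trans (le_of_eq ?_)
    exact (trunc_map_restr T j.symm hb hK h1 hle P'.str).symm
  · change τ.map (restr j.symm hK) (isometry_restr j.symm hK) P'.str ≤ _
    rw [← hj.symm.2 _ _ hK]
    exact τ.monotone_map _ _ h2
  · have hc := cball_image i hi.1 ε⁻¹
    exact dc_le_of_iso (A := (𝒳.ball ε⁻¹).toCompactTuple) (A' := (𝒳'.ball ε⁻¹).toCompactTuple)
      (B := P.toCompactTuple) (B' := P'.toCompactTuple)
      (restr i hc) (isometry_restr i hc) (restr_surjective i hc) (Subtype.ext hi.1)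
      (hi.2 _ _ hc) (restr j hK') (isometry_restr j hK') (restr_surjective j hK')
      (Subtype.ext hj.1) (map_map_eq_self _ _ (restr_restr_symm j hK' hK) _)

theorem Tuple.dist_congr {𝒳 𝒳' 𝒴 𝒴' : Tuple T} (hX : ∃ e, 𝒳.IsIso 𝒳' e)
    (hY : ∃ e, 𝒴.IsIso 𝒴' e) : 𝒳.dist 𝒴 = 𝒳'.dist 𝒴' := by
  obtain ⟨i, hi⟩ := hX
  obtain ⟨j, hj⟩ := hY
  have h1 : ∀ ε, aFun ε 𝒳 𝒴 = aFun ε 𝒳' 𝒴' := fun ε =>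
    le_antisymm (aFun_le_of_iso hi hj ε) (aFun_le_of_iso hi.symm hj.symm ε)
  have h2 : ∀ ε, aFun ε 𝒴 𝒳 = aFun ε 𝒴' 𝒳' := fun ε =>
    le_antisymm (aFun_le_of_iso hj hi ε) (aFun_le_of_iso hj.symm hi.symm ε)
  simp only [Tuple.dist, h1, h2]

variable (T)

/-- The space `𝒞'` of isomorphism classes of tuples. -/
def CPrime : Type (max (u + 1) v) := Quotient (tupleSetoid T)

/-- The distance on `𝒞'`. -/
noncomputable def CPrime.dist (x y : CPrime T) : ℝ≥0 :=
  Quotient.liftOn₂ (s₁ := tupleSetoid T) (s₂ := tupleSetoid T) x y Tuple.dist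
    fun _ _ _ _ hX hY => Tuple.dist_congr hX hY

/-- For compact `𝒳`, `𝒴` and `𝒳' ≼ 𝒳` there is `𝒴' ≼ 𝒴` with
`d^c(𝒳', 𝒴') ≤ d^c(𝒳, 𝒴)`. -/
def Truncation.SubsetProperty : Prop :=
  ∀ (A B : CompactTuple τ) (P : Piece (A.toTuple T)), P.Below →
    ∃ Q : Piece (B.toTuple T), Q.Below ∧ dc P.toCompactTuple Q.toCompactTuple ≤ dc A B

/-- In the previous property, if moreover `𝒳^(r) ≼ 𝒳'` and `r ≥ 2 ε` with `ε = d^c(𝒳, 𝒴)`, then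
`𝒴'` can be chosen with `𝒴^(r - 2 ε) ≼ 𝒴'`. -/
def Truncation.BallSubsetProperty : Prop :=
  ∀ (A B : CompactTuple τ) (P : Piece (A.toTuple T)) (r ε : ℝ≥0), dc A B = ε → 2 * ε ≤ r →
    ((A.toTuple T).ball r).Le P → P.Below →
    ∃ Q : Piece (B.toTuple T), ((B.toTuple T).ball (r - 2 * ε)).Le Q ∧ Q.Below ∧
      dc P.toCompactTuple Q.toCompactTuple ≤ dc A B

end Spaces

/-- Every Cauchy sequence for the distance function `d` converges. -/
def CauchyComplete {C : Type*} (d : C → C → ℝ≥0) : Prop :=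
  ∀ x : ℕ → C, (∀ ε > 0, ∃ N, ∀ m ≥ N, ∀ n ≥ N, d (x m) (x n) < ε) →
    ∃ y, ∀ ε > 0, ∃ N, ∀ n ≥ N, d (x n) y < ε

/-- There is a countable set that is dense for the distance function `d`. -/
def CountablyDense {C : Type*} (d : C → C → ℝ≥0) : Prop :=
  ∃ S : Set C, S.Countable ∧ ∀ x, ∀ ε > 0, ∃ y ∈ S, d x y < ε

end GHF

/-! Everything is phrased through embeddings rather than subsets. Since `τ_f` is left adjoint to
truncation (`Truncation.map_le_iff`), a piece between the ball of radius `r` of `𝒳` and `𝒳` is, up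
to isomorphism, a tuple `A` below a larger ball of `𝒳` through which every tuple below that ball and
of radius at most `r` factors (`Sand`, `TSand`). Such sandwiches compose, and the ball subset
property carries them across a small `d^c` at the cost of `2 d^c` in the radius. The bound `ε / 2`
in the definition of `d` makes this cost less than `ε`. This gives a triangle inequality for `ε + δ
≤ 1`, and the criterion `mutuallyClose_of_tsand`: two tuples are close as soon as `d^c`-close
compact tuples containing large balls lie below them.

Completeness: let `Y` be a rapidly Cauchy sequence. Carrying a ball of `Y k` along the sequence
gives compact tuples `A k m` below `Y (k + m)`, of radius about `2 ^ (k + 3)`, that are `d^c`-Cauchy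
in `m`. They have a limit `B k`, because the values of `τ` are complete and limits of structures
live on limits of subspaces (`exists_tendsto_dc`). Both `A k (m + 1)` and `A (k + 1) m` lie below `Y
(k + m + 1)`, so the smaller is sandwiched in the larger. The heart of the proof is that this
survives the limit (`exists_sand_of_forall_dc_lt`): compactness yields embeddings of `B k` below `B
(k + 1)` and of a ball of `B (k + 1)` below `B k`; composed, they map that ball isometrically onto
itself without increasing the structure, so rigidity makes the composite an automorphism. The direct
limit of the `B k` is the limit of `Y` (`exists_tuple_of_sand`).

Separability: only the ball of radius `1/δ` matters up to `δ`. Its space is approximated by a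
countable Gromov-Hausdorff dense family, and Hausdorff continuity provides nearby structures on the
approximating spaces. -/

namespace GHF

/-! ### Isometries of compact spaces and gluing -/

section MetricGeometry

/-- An isometry through whose range another isometry factors. -/
theorem exists_isometry_lift {X Y Z : Type*} [MetricSpace X] [MetricSpace Y] [MetricSpace Z]
    {f : X → Z} (hf : Isometry f) {g : Y → Z} (hg : Isometry g) (h : ∀ y, g y ∈ Set.range f) :
    ∃ g' : Y → X, Isometry g' ∧ ∀ y, f (g' y) = g y := by
  choose g' hg' using h
  exact ⟨g', fun x y => by rw [← hf.edist_eq, hg', hg', hg.edist_eq], hg'⟩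

/-- An isometric self-map of a compact space is surjective. -/
theorem surjective_of_isometry {X : Type*} [MetricSpace X] [CompactSpace X] {f : X → X}
    (hf : Isometry f) : Function.Surjective f := by
  intro x
  by_contra hx
  have hcl : IsClosed (Set.range f) := (isCompact_range hf.continuous).isClosed
  obtain ⟨δ, hδ, hball⟩ := Metric.isOpen_iff.1 hcl.isOpen_compl x hx
  -- If `x` has distance at least `δ` from the range, its iterates are pairwise at least `δ` apart,
  -- since `f^[N]` is an isometry. So no subsequence of them can converge.
  obtain ⟨y, φ, hφ, hy⟩ := CompactSpace.tendsto_subseq (fun n => f^[n] x)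
  obtain ⟨N, hN⟩ := Metric.cauchySeq_iff.1 hy.cauchySeq δ hδ
  have h1 := hN N le_rfl (N + 1) (Nat.le_succ N)
  have hlt : φ N < φ (N + 1) := hφ (Nat.lt_succ_self N)
  obtain ⟨k, hk⟩ := Nat.exists_eq_add_of_lt hlt
  simp only [Function.comp] at h1
  have hit : ∀ n, Isometry (f^[n]) := fun n => by
    induction n with
    | zero => exact isometry_id
    | succ n ih => exact ih.comp hf
  rw [hk, add_assoc, Function.iterate_add_apply, (hit (φ N)).dist_eq] at h1
  have h2 : f^[k + 1] x ∈ Set.range f := ⟨f^[k] x, (Function.iterate_succ_apply' f k x).symm⟩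
  exact hball (Metric.mem_ball'.2 h1) h2

/-- A sequence of isometries between compact spaces has a subsequence that converges
pointwise to an isometry. -/
theorem exists_subseq_tendsto_isometry {X Y : Type*} [MetricSpace X] [CompactSpace X]
    [MetricSpace Y] [CompactSpace Y] (f : ℕ → X → Y) (hf : ∀ n, Isometry (f n)) :
    ∃ (g : X → Y) (φ : ℕ → ℕ), Isometry g ∧ StrictMono φ ∧
      ∀ x, Tendsto (fun n => f (φ n) x) atTop (𝓝 (g x)) := by
  let F : ℕ → BoundedContinuousFunction X Y := fun n =>
    BoundedContinuousFunction.mkOfCompact ⟨f n, (hf n).continuous⟩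
  let A : Set (BoundedContinuousFunction X Y) := {g | Isometry g}
  have hAcl : IsClosed A := by
    have : A = ⋂ (x) (y), {g | dist (g x) (g y) = dist x y} := by
      ext g
      simp [A, isometry_iff_dist_eq]
    rw [this]
    refine isClosed_iInter fun x => isClosed_iInter fun y => isClosed_eq ?_ continuous_const
    exact (BoundedContinuousFunction.lipschitz_eval_const x).continuous.dist
      (BoundedContinuousFunction.lipschitz_eval_const y).continuous
  have hA : IsCompact A := by
    refine BoundedContinuousFunction.arzela_ascoli₁ A hAcl ?_
    refine Metric.equicontinuous_of_continuity_modulus id tendsto_id _ ?_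
    intro x y g
    exact (g.2.dist_eq x y).le
  obtain ⟨g, hg, φ, hφ, hlim⟩ := hA.tendsto_subseq (x := F) (fun n => hf n)
  refine ⟨g, φ, hg, hφ, fun x => ?_⟩
  exact ((BoundedContinuousFunction.lipschitz_eval_const x).continuous.tendsto g).comp hlim

/-- Gluing two compact spaces along a common subspace. -/
theorem exists_compact_glue {C X Y : Type u} [MetricSpace C] [Nonempty C] [MetricSpace X]
    [CompactSpace X] [MetricSpace Y] [CompactSpace Y] {f : C → X} (hf : Isometry f) {g : C → Y}
    (hg : Isometry g) :
    ∃ (Z : Type u) (_ : MetricSpace Z) (_ : CompactSpace Z) (p : X → Z) (q : Y → Z),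
      Isometry p ∧ Isometry q ∧ ∀ c, p (f c) = q (g c) := by
  have hL := Metric.toGlueL_isometry hf hg
  have hR := Metric.toGlueR_isometry hf hg
  refine ⟨Metric.GlueSpace hf hg, inferInstance, ⟨?_⟩, _, _, hL, hR,
    fun c => congrFun (Metric.toGlue_commute hf hg) c⟩
  have : (Set.univ : Set (Metric.GlueSpace hf hg)) =
      Set.range (Metric.toGlueL hf hg) ∪ Set.range (Metric.toGlueR hf hg) := by
    refine (Set.eq_univ_of_forall ?_).symm
    rintro ⟨x | y⟩
    · exact Or.inl ⟨x, rfl⟩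
    · exact Or.inr ⟨y, rfl⟩
  rw [this]
  exact (isCompact_range hL.continuous).union (isCompact_range hR.continuous)

/-- A metric space together with an embedding of a given one. -/
structure Extension (W : Type u) [MetricSpace W] where
  space : Type u
  metric : MetricSpace space
  embed : W → space
  isom : Isometry embed

attribute [local instance] Extension.metric

/-- The spaces obtained by successively gluing `W 0, …, W n`, where `W n` and `W (n + 1)` are glued
along `A (n + 1)`. -/
noncomputable def successiveGlue {A W : ℕ → Type u} [∀ n, MetricSpace (A n)] [∀ n, MetricSpace (W n)]
    [∀ n, Nonempty (A n)] {l : ∀ n, A n → W n} {r : ∀ n, A (n + 1) → W n}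
    (hl : ∀ n, Isometry (l n)) (hr : ∀ n, Isometry (r n)) : ∀ n, Extension (W n)
  | 0 => ⟨W 0, inferInstance, id, isometry_id⟩
  | n + 1 =>
    { space := Metric.GlueSpace ((successiveGlue hl hr n).isom.comp (hr n)) (hl (n + 1))
      metric := inferInstance
      embed := Metric.toGlueR ((successiveGlue hl hr n).isom.comp (hr n)) (hl (n + 1))
      isom := Metric.toGlueR_isometry _ _ }

/-- Infinitely many spaces `W n`, where `W n` and `W (n + 1)` are glued along `A (n + 1)`, embed
into one complete space. -/
theorem exists_complete_glue {A W : ℕ → Type u} [∀ n, MetricSpace (A n)] [∀ n, MetricSpace (W n)]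
    [∀ n, Nonempty (A n)] {l : ∀ n, A n → W n} {r : ∀ n, A (n + 1) → W n}
    (hl : ∀ n, Isometry (l n)) (hr : ∀ n, Isometry (r n)) :
    ∃ (Z : Type u) (_ : MetricSpace Z) (_ : CompleteSpace Z) (h : ∀ n, W n → Z),
      (∀ n, Isometry (h n)) ∧ ∀ n x, h n (r n x) = h (n + 1) (l (n + 1) x) := by
  let Y := successiveGlue hl hr
  let f : ∀ n, (Y n).space → (Y (n + 1)).space := fun n =>
    Metric.toGlueL ((Y n).isom.comp (hr n)) (hl (n + 1))
  have I : ∀ n, Isometry (f n) := fun n => Metric.toGlueL_isometry _ _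
  refine ⟨UniformSpace.Completion (Metric.InductiveLimit I), inferInstance, inferInstance,
    fun n x => ((Metric.toInductiveLimit I n ((Y n).embed x) : Metric.InductiveLimit I) :
      UniformSpace.Completion (Metric.InductiveLimit I)), fun n => ?_, fun n x => ?_⟩
  · exact UniformSpace.Completion.coe_isometry.comp
      ((Metric.toInductiveLimit_isometry I n).comp (Y n).isom)
  · refine congrArg _ ?_
    rw [← Metric.toInductiveLimit_commute I n]
    exact congrArg _ (congrFun (Metric.toGlue_commute ((Y n).isom.comp (hr n)) (hl (n + 1))) x)

/-- If moreover all points of `W n` are close to `A n`, then the ambient space can be chosen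
compact. -/
theorem exists_compact_glue_seq {A W : ℕ → Type u} [∀ n, MetricSpace (A n)]
    [∀ n, MetricSpace (W n)] [∀ n, CompactSpace (W n)]
    [∀ n, Nonempty (A n)] {l : ∀ n, A n → W n} {r : ∀ n, A (n + 1) → W n}
    (hl : ∀ n, Isometry (l n)) (hr : ∀ n, Isometry (r n))
    (hd : ∀ n (w : W n), ∃ x, dist w (l n x) ≤ (1 / 2 : ℝ) ^ n) :
    ∃ (Z : Type u) (_ : MetricSpace Z) (_ : CompactSpace Z) (h : ∀ n, W n → Z),
      (∀ n, Isometry (h n)) ∧ ∀ n x, h n (r n x) = h (n + 1) (l (n + 1) x) := by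
  obtain ⟨Z, _, _, h, hh, hcomm⟩ := exists_complete_glue hl hr
  let S : Set Z := ⋃ n, Set.range (h n)
  -- Moving from `W (N + m)` back to `W N` costs `(1/2)^(N+1) + ... + (1/2)^(N+m)`. Hence, up to a
  -- small error, the union is covered by finitely many of the compact spaces.
  have key : ∀ N m (w : W (N + m)), ∃ w' : W N,
      dist (h (N + m) w) (h N w') ≤ (1 / 2 : ℝ) ^ N * (1 - (1 / 2) ^ m) := by
    intro N m
    induction m with
    | zero => exact fun w => ⟨w, by simp⟩
    | succ m ih =>
      intro w
      obtain ⟨x, hx⟩ := hd (N + m + 1) w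
      obtain ⟨w', hw'⟩ := ih (r (N + m) x)
      refine ⟨w', ?_⟩
      have h1 : dist (h (N + m + 1) w) (h (N + m + 1) (l (N + m + 1) x)) ≤
          (1 / 2 : ℝ) ^ (N + m + 1) := by rwa [(hh _).dist_eq]
      rw [hcomm] at hw'
      refine (dist_triangle _ _ _).trans ((add_le_add h1 hw').trans (le_of_eq ?_))
      rw [pow_succ, pow_add, pow_succ]
      ring
  have hS : TotallyBounded S := by
    rw [Metric.totallyBounded_iff]
    intro ε hε
    obtain ⟨N, hN⟩ := exists_pow_lt_of_lt_one (half_pos hε) (by norm_num : (1 / 2 : ℝ) < 1)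
    have hcomp : IsCompact (⋃ n ∈ Finset.range (N + 1), Set.range (h n)) :=
      (Finset.range (N + 1)).isCompact_biUnion fun n _ => isCompact_range (hh n).continuous
    obtain ⟨t, ht, hcov⟩ := Metric.totallyBounded_iff.1 hcomp.totallyBounded (ε / 2) (half_pos hε)
    refine ⟨t, ht, ?_⟩
    intro z hz
    obtain ⟨n, w, rfl⟩ := Set.mem_iUnion.1 hz
    obtain ⟨z', hz', hdz⟩ : ∃ z' ∈ ⋃ n ∈ Finset.range (N + 1), Set.range (h n),
        dist (h n w) z' < ε / 2 := by
      rcases le_total n N with hn | hn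
      · refine ⟨h n w, ?_, by simpa using half_pos hε⟩
        simp only [Set.mem_iUnion, Finset.mem_range]
        exact ⟨n, Nat.lt_succ_of_le hn, w, rfl⟩
      · obtain ⟨m, rfl⟩ := Nat.exists_eq_add_of_le hn
        obtain ⟨w', hw'⟩ := key N m w
        refine ⟨h N w', ?_, hw'.trans_lt (lt_of_le_of_lt ?_ hN)⟩
        · simp only [Set.mem_iUnion, Finset.mem_range]
          exact ⟨N, Nat.lt_succ_self N, w', rfl⟩
        · refine mul_le_of_le_one_right (by positivity) ?_
          linarith [show (0 : ℝ) ≤ (1 / 2) ^ m by positivity]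
    have h2 := hcov hz'
    simp only [Set.mem_iUnion, Metric.mem_ball] at h2 ⊢
    obtain ⟨c, hc, hzc⟩ := h2
    exact ⟨c, hc, by linarith [dist_triangle (h n w) z' c]⟩
  have hK : IsCompact (closure S) := hS.closure.isCompact_of_isClosed isClosed_closure
  refine ⟨closure S, inferInstance, isCompact_iff_compactSpace.1 hK,
    fun n w => ⟨h n w, subset_closure (Set.mem_iUnion.2 ⟨n, w, rfl⟩)⟩, fun n => ?_, fun n x => ?_⟩
  · exact fun x y => hh n x y
  · exact Subtype.ext (hcomm n x)

/-- Spaces `W n` containing a common subspace `B` that approximates them embed, relative to `B`,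
into one compact space. -/
theorem exists_compact_star_glue {B : Type u} {W : ℕ → Type u} [MetricSpace B] [Nonempty B]
    [∀ n, MetricSpace (W n)] [∀ n, CompactSpace (W n)] {j : ∀ n, B → W n}
    (hj : ∀ n, Isometry (j n)) (hd : ∀ n (w : W n), ∃ x, dist w (j n x) ≤ (1 / 2 : ℝ) ^ n) :
    ∃ (Z : Type u) (_ : MetricSpace Z) (_ : CompactSpace Z) (g : B → Z) (h : ∀ n, W n → Z),
      Isometry g ∧ (∀ n, Isometry (h n)) ∧ ∀ n x, h n (j n x) = g x := by
  -- With `l = r = j`, each step of the chain glues along the same `B`, so all copies of `B`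
  -- coincide in `Z`.
  obtain ⟨Z, i1, i2, h, hh, hcomm⟩ :=
    exists_compact_glue_seq (A := fun _ => B) (l := j) (r := j) hj hj hd
  refine ⟨Z, i1, i2, h 0 ∘ j 0, h, (hh 0).comp (hj 0), hh, fun n => ?_⟩
  induction n with
  | zero => exact fun x => rfl
  | succ n ih => exact fun x => (hcomm n x).symm.trans (ih x)

/-- Two isometric embeddings into a compact space, regarded as embeddings into the union of their
images. -/
theorem exists_compact_corestrict {X Y Z : Type u} [MetricSpace X] [CompactSpace X] [MetricSpace Y]
    [CompactSpace Y] [MetricSpace Z] {f : X → Z} (hf : Isometry f) {g : Y → Z} (hg : Isometry g) :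
    ∃ (W : Type u) (_ : MetricSpace W) (_ : CompactSpace W) (f' : X → W) (g' : Y → W) (i : W → Z),
      Isometry f' ∧ Isometry g' ∧ Isometry i ∧ (∀ x, i (f' x) = f x) ∧ (∀ y, i (g' y) = g y) ∧
        ∀ w, w ∈ Set.range f' ∨ w ∈ Set.range g' := by
  refine ⟨(Set.range f ∪ Set.range g : Set Z), inferInstance,
    isCompact_iff_compactSpace.1
      ((isCompact_range hf.continuous).union (isCompact_range hg.continuous)),
    fun x => ⟨f x, Or.inl ⟨x, rfl⟩⟩, fun y => ⟨g y, Or.inr ⟨y, rfl⟩⟩, Subtype.val,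
    fun x y => hf x y, fun x y => hg x y, isometry_subtype_coe, fun _ => rfl, fun _ => rfl, ?_⟩
  rintro ⟨_, ⟨x, rfl⟩ | ⟨y, rfl⟩⟩
  · exact Or.inl ⟨x, rfl⟩
  · exact Or.inr ⟨y, rfl⟩

end MetricGeometry

/-! ### Subtuples, sandwiches and the distance of compact tuples -/

section Subtuples

variable {τ : PosFunctor.{u, v}}

instance (A : CompactTuple τ) : Nonempty A.carrier := ⟨A.origin⟩

/-- Truncation is right adjoint to `τ`. -/
theorem Truncation.map_le_iff (T : Truncation τ) {X Y : Type u} [MetricSpace X] [CompactSpace X]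
    [MetricSpace Y] [CompactSpace Y] {f : X → Y} (hf : Isometry f) {a : τ.obj X} {b : τ.obj Y} :
    τ.map f hf a ≤ b ↔ a ≤ T.trunc f hf b := by
  constructor
  · intro h
    rw [← T.trunc_map f hf a]
    exact T.monotone_trunc f hf h
  · intro h
    exact (τ.monotone_map f hf h).trans (T.map_trunc_le f hf b)

/-- `τ (g ∘ f) = τ g ∘ τ f`, for a composition that is only given pointwise. -/
theorem map_map_of_comp_eq {X Y Z : Type u} [MetricSpace X] [CompactSpace X] [MetricSpace Y]
    [CompactSpace Y] [MetricSpace Z] [CompactSpace Z] {f : X → Y} {g : Y → Z} {h : X → Z}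
    (hf : Isometry f) (hg : Isometry g) (hh : Isometry h) (e : ∀ x, g (f x) = h x) (a : τ.obj X) :
    τ.map g hg (τ.map f hf a) = τ.map h hh a := by
  rw [← τ.map_comp]
  exact map_congr _ _ (funext e) a

theorem trunc_trunc_of_comp_eq (T : Truncation τ) {X Y Z : Type u} [MetricSpace X] [CompactSpace X]
    [MetricSpace Y] [CompactSpace Y] [MetricSpace Z] [CompactSpace Z] {f : X → Y} {g : Y → Z}
    {h : X → Z} (hf : Isometry f) (hg : Isometry g) (hh : Isometry h) (e : ∀ x, g (f x) = h x)
    (c : τ.obj Z) : T.trunc f hf (T.trunc g hg c) = T.trunc h hh c := by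
  rw [← T.trunc_comp]
  exact trunc_congr T _ _ (funext e) c

/-- As `τ_i` is an isometry, enlarging or shrinking the ambient space does not affect the distance
of structures. -/
theorem edist_map_map_of_comp_eq {X Y W Z : Type u} [MetricSpace X] [CompactSpace X]
    [MetricSpace Y] [CompactSpace Y] [MetricSpace W] [CompactSpace W] [MetricSpace Z]
    [CompactSpace Z] {f' : X → W} {g' : Y → W} {i : W → Z} {f : X → Z} {g : Y → Z}
    (hf' : Isometry f') (hg' : Isometry g') (hi : Isometry i) (hf : Isometry f) (hg : Isometry g)
    (ef : ∀ x, i (f' x) = f x) (eg : ∀ y, i (g' y) = g y) (a : τ.obj X) (b : τ.obj Y) :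
    edist (τ.map f' hf' a) (τ.map g' hg' b) = edist (τ.map f hf a) (τ.map g hg b) := by
  rw [← (τ.isometry_map i hi).edist_eq, map_map_of_comp_eq hf' hi hf ef,
    map_map_of_comp_eq hg' hi hg eg]

/-- `f` embeds `A` into `B` in such a way that its structure lies below that of `B`. -/
structure IsSub (A B : CompactTuple τ) (f : A.carrier → B.carrier) : Prop where
  isom : Isometry f
  origin : f A.origin = B.origin
  le : τ.map f isom A.str ≤ B.str

theorem IsSub.comp {A B C : CompactTuple τ} {f : A.carrier → B.carrier} {g : B.carrier → C.carrier}
    (hg : IsSub B C g) (hf : IsSub A B f) : IsSub A C (g ∘ f) where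
  isom := hg.isom.comp hf.isom
  origin := by simp [hf.origin, hg.origin]
  le := by
    rw [τ.map_comp f hf.isom g hg.isom]
    exact (τ.monotone_map _ _ hf.le).trans hg.le

theorem IsSub.dist_origin {A B : CompactTuple τ} {f : A.carrier → B.carrier} (hf : IsSub A B f)
    (x : A.carrier) : dist (f x) B.origin = dist x A.origin := by
  rw [← hf.origin, hf.isom.dist_eq]

/-- `f` embeds `A` between the ball of radius `r` of `B` and `B`, that is, `A` lies below `B` and
every tuple below the ball of radius `r` of `B` lies below `A`. -/
def Sand (r : ℝ≥0) (A B : CompactTuple τ) (f : A.carrier → B.carrier) : Prop :=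
  IsSub A B f ∧ ∀ (D : CompactTuple τ) (h : D.carrier → B.carrier), IsSub D B h →
    (∀ x, dist (h x) B.origin ≤ r) → ∃ h', IsSub D A h' ∧ ∀ x, f (h' x) = h x

theorem Sand.mono {r s : ℝ≥0} {A B : CompactTuple τ} {f : A.carrier → B.carrier}
    (hf : Sand r A B f) (h : s ≤ r) : Sand s A B f :=
  ⟨hf.1, fun D k hk hb => hf.2 D k hk fun x => (hb x).trans (NNReal.coe_le_coe.2 h)⟩

theorem Sand.comp {r : ℝ≥0} {A B C : CompactTuple τ} {f : A.carrier → B.carrier}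
    {g : B.carrier → C.carrier} (hg : Sand r B C g) (hf : Sand r A B f) :
    Sand r A C (g ∘ f) := by
  refine ⟨hg.1.comp hf.1, fun D h hh hb => ?_⟩
  obtain ⟨k, hk, ek⟩ := hg.2 D h hh hb
  obtain ⟨l, hl, el⟩ := hf.2 D k hk fun x => by
    rw [← hg.1.dist_origin, ek]
    exact hb x
  exact ⟨l, hl, fun x => by simp [el, ek]⟩

/-- A tuple below `B` is also below `C`, at the same distance from the origin, so it factors through
`A`. This extracts a sandwich between two tuples that lie below a common one. -/
theorem Sand.of_comp {r : ℝ≥0} {A B C : CompactTuple τ} {f : A.carrier → B.carrier}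
    {g : B.carrier → C.carrier} {h : A.carrier → C.carrier} (hh : Sand r A C h) (hg : IsSub B C g)
    (hf : IsSub A B f) (e : ∀ x, g (f x) = h x) : Sand r A B f := by
  refine ⟨hf, fun D k hk hb => ?_⟩
  obtain ⟨l, hl, el⟩ := hh.2 D (g ∘ k) (hg.comp hk) fun x => by
    rw [Function.comp, hg.dist_origin]
    exact hb x
  exact ⟨l, hl, fun x => hg.isom.injective (by rw [e, el]; rfl)⟩

theorem isSub_id (A : CompactTuple τ) : IsSub A A id :=
  ⟨isometry_id, rfl, (τ.map_id A.str).le⟩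

theorem sand_id (r : ℝ≥0) (A : CompactTuple τ) : Sand r A A id :=
  ⟨isSub_id A, fun _ h hh _ => ⟨h, hh, fun _ => rfl⟩⟩

/-- The source of all sandwiches by balls: the hypothesis on the range lifts the points, the
adjunction lifts the structure. -/
theorem sand_of_trunc (T : Truncation τ) {r : ℝ≥0} {A B : CompactTuple τ}
    {f : A.carrier → B.carrier} (hf : Isometry f) (ho : f A.origin = B.origin)
    (hs : A.str = T.trunc f hf B.str) (hr : ∀ y, dist y B.origin ≤ r → y ∈ Set.range f) :
    Sand r A B f := by
  refine ⟨⟨hf, ho, (T.map_le_iff hf).2 hs.le⟩, fun D h hh hb => ?_⟩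
  obtain ⟨h', ih, eh⟩ := exists_isometry_lift hf hh.isom fun x => hr _ (hb x)
  refine ⟨h', ⟨ih, hf.injective ?_, ?_⟩, eh⟩
  · rw [eh, hh.origin, ho]
  · rw [hs, ← T.map_le_iff, map_map_of_comp_eq ih hf hh.isom eh]
    exact hh.le

/-- Truncations of `A` and of `B` to a space inside the ball of radius `r` agree. -/
theorem Sand.trunc_eq (T : Truncation τ) {r : ℝ≥0} {A B : CompactTuple τ}
    {f : A.carrier → B.carrier} (hf : Sand r A B f) {K : Type u} [MetricSpace K] [CompactSpace K]
    {p : K → A.carrier} (hp : Isometry p) {q : K → B.carrier} (hq : Isometry q)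
    (e : ∀ x, f (p x) = q x) (hb : ∀ x, dist (p x) A.origin ≤ r) :
    T.trunc p hp A.str = T.trunc q hq B.str := by
  apply le_antisymm
  · rw [← trunc_trunc_of_comp_eq T hp hf.1.isom hq e]
    exact T.monotone_trunc _ _ ((T.map_le_iff _).1 hf.1.le)
  -- For the other inequality, the ball of radius `r` of `B` serves as test tuple: it factors
  -- through `A` by the sandwich property, and `K` maps into it.
  · let D : CompactTuple τ := ((B.toTuple T).ball r).toCompactTuple
    have hD : Sand r D B Subtype.val :=
      sand_of_trunc T isometry_subtype_coe rfl rfl fun y hy => ⟨⟨y, hy⟩, rfl⟩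
    obtain ⟨h, hh, eh⟩ := hf.2 D _ hD.1 fun x => x.2
    let k : K → D.carrier := fun x => ⟨q x, by
      change dist (q x) B.origin ≤ r
      rw [← e, hf.1.dist_origin]
      exact hb x⟩
    have hk : Isometry k := fun x y => hq x y
    rw [← trunc_trunc_of_comp_eq T hk hD.1.isom hq (fun _ => rfl)]
    refine (T.monotone_trunc k hk ((T.map_le_iff hh.isom).1 hh.le)).trans (le_of_eq ?_)
    refine trunc_trunc_of_comp_eq T hk hh.isom hp (fun x => hf.1.isom.injective ?_) _
    rw [eh, e]

/-! ### The distance of compact tuples -/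

theorem dc_le_of_embeddings {A B : CompactTuple τ} {c : ℝ≥0∞} {Z : Type u} [MetricSpace Z]
    [CompactSpace Z] {f : A.carrier → Z} (hf : Isometry f) {g : B.carrier → Z} (hg : Isometry g)
    (h1 : Metric.hausdorffEDist (Set.range f) (Set.range g) ≤ c)
    (h2 : edist (f A.origin) (g B.origin) ≤ c)
    (h3 : edist (τ.map f hf A.str) (τ.map g hg B.str) ≤ c) : dc A B ≤ c := by
  refine iInf_le_of_le Z <| iInf_le_of_le ‹_› <| iInf_le_of_le ‹_› <| iInf_le_of_le f <|
    iInf_le_of_le hf <| iInf_le_of_le g <| iInf_le_of_le hg ?_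
  exact max_le h1 (max_le h2 h3)

theorem exists_embeddings_of_dc_lt {A B : CompactTuple τ} {c : ℝ≥0∞} (h : dc A B < c) :
    ∃ (Z : Type u) (_ : MetricSpace Z) (_ : CompactSpace Z) (f : A.carrier → Z) (hf : Isometry f)
      (g : B.carrier → Z) (hg : Isometry g),
      Metric.hausdorffEDist (Set.range f) (Set.range g) < c ∧
      edist (f A.origin) (g B.origin) < c ∧
      edist (τ.map f hf A.str) (τ.map g hg B.str) < c := by
  simp only [dc, MetricFunctor.ghf, iInf_lt_iff] at h
  obtain ⟨Z, i1, i2, f, hf, g, hg, h⟩ := h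
  obtain ⟨h1, h2⟩ := max_lt_iff.1 h
  obtain ⟨h2, h3⟩ := max_lt_iff.1 (show max (edist (f A.origin) (g B.origin))
    (edist (τ.map f hf A.str) (τ.map g hg B.str)) < c from h2)
  exact ⟨Z, i1, i2, f, hf, g, hg, h1, h2, h3⟩

theorem dc_comm (A B : CompactTuple τ) : dc A B = dc B A := by
  have key : ∀ A B : CompactTuple τ, dc A B ≤ dc B A := fun A B => by
    refine le_of_forall_gt fun c hc => ?_
    obtain ⟨c', hc', hcc⟩ := exists_between hc
    obtain ⟨Z, _, _, f, hf, g, hg, h1, h2, h3⟩ := exists_embeddings_of_dc_lt hc'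
    refine (dc_le_of_embeddings hg hf ?_ ?_ ?_).trans_lt hcc
    · rw [Metric.hausdorffEDist_comm]; exact h1.le
    · rw [edist_comm]; exact h2.le
    · rw [edist_comm]; exact h3.le
  exact le_antisymm (key A B) (key B A)

theorem dc_self (A : CompactTuple τ) : dc A A = 0 :=
  nonpos_iff_eq_zero.1 (dc_le_of_embeddings isometry_id isometry_id (by simp) (by simp) (by simp))

/-- Almost optimal ambient spaces for `(A, B)` and `(B, C)` are glued along `B`. -/
theorem dc_triangle (A B C : CompactTuple τ) : dc A C ≤ dc A B + dc B C := by
  refine le_of_forall_gt fun c hc => ?_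
  obtain ⟨x, hx, hxc⟩ : ∃ x, dc A B < x ∧ x + dc B C < c := by
    obtain ⟨x, hx, hx'⟩ := exists_between (lt_tsub_iff_right.2 hc)
    exact ⟨x, hx, lt_tsub_iff_right.1 hx'⟩
  obtain ⟨y, hy, hyc⟩ : ∃ y, dc B C < y ∧ x + y < c := by
    obtain ⟨y, hy, hy'⟩ := exists_between (lt_tsub_iff_left.2 hxc)
    exact ⟨y, hy, lt_tsub_iff_left.1 hy'⟩
  obtain ⟨Z, _, _, f, hf, g, hg, h1, h2, h3⟩ := exists_embeddings_of_dc_lt hx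
  obtain ⟨Z', _, _, g', hg', k, hk, k1, k2, k3⟩ := exists_embeddings_of_dc_lt hy
  obtain ⟨W, _, _, p, q, hp, hq, hpq⟩ := exists_compact_glue hg hg'
  have e : p ∘ g = q ∘ g' := funext hpq
  refine (dc_le_of_embeddings (c := x + y) (hp.comp hf) (hq.comp hk) ?_ ?_ ?_).trans_lt hyc
  · refine (Metric.hausdorffEDist_triangle (t := Set.range (p ∘ g))).trans (add_le_add ?_ ?_)
    · rw [Set.range_comp, Set.range_comp, Metric.hausdorffEDist_image hp]
      exact h1.le
    · rw [e, Set.range_comp, Set.range_comp, Metric.hausdorffEDist_image hq]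
      exact k1.le
  · refine (edist_triangle _ (p (g B.origin)) _).trans (add_le_add ?_ ?_)
    · rw [Function.comp, hp.edist_eq]
      exact h2.le
    · rw [hpq, Function.comp, hq.edist_eq]
      exact k2.le
  · refine (edist_triangle _ (τ.map (p ∘ g) (hp.comp hg) B.str) _).trans (add_le_add ?_ ?_)
    · rw [← edist_map_map_of_comp_eq hf hg hp (hp.comp hf) (hp.comp hg) (fun _ => rfl) (fun _ => rfl)]
      exact h3.le
    · rw [map_congr (hp.comp hg) (hq.comp hg') e,
        ← edist_map_map_of_comp_eq hg' hk hq (hq.comp hg') (hq.comp hk) (fun _ => rfl) (fun _ => rfl)]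
      exact k3.le

theorem dist_lt_half_of_edist_lt {X : Type*} [MetricSpace X] {x y : X} {δ : ℝ≥0}
    (h : edist x y < (δ : ℝ≥0∞) / 2) : dist x y < δ / 2 := by
  have h2 : (δ : ℝ≥0∞) / 2 = ((δ / 2 : ℝ≥0) : ℝ≥0∞) := by simp
  rw [h2, edist_nndist, ENNReal.coe_lt_coe, ← NNReal.coe_lt_coe] at h
  simpa using h

/-- If `A` is bounded by `r`, then `B` is bounded by `r + 2 d^c(A, B)`. -/
theorem dist_origin_le_of_dc_lt {A B : CompactTuple τ} {r : ℝ} {δ : ℝ≥0}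
    (h : dc A B < (δ : ℝ≥0∞) / 2) (hA : ∀ x, dist x A.origin ≤ r) (y : B.carrier) :
    dist y B.origin ≤ r + δ := by
  obtain ⟨Z, _, _, f, hf, g, hg, h1, h2, -⟩ := exists_embeddings_of_dc_lt h
  rw [Metric.hausdorffEDist_comm] at h1
  obtain ⟨_, ⟨x, rfl⟩, hx⟩ := Metric.exists_edist_lt_of_hausdorffEDist_lt (Set.mem_range_self y) h1
  have hx' := dist_lt_half_of_edist_lt hx
  have h2' := dist_lt_half_of_edist_lt h2
  have h4 := hA x
  rw [← hf.dist_eq] at h4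
  rw [← hg.dist_eq]
  linarith [dist_triangle4 (g y) (f x) (f A.origin) (g B.origin)]

/-- A map of tuples that is an isomorphism does not change the distance. -/
theorem dc_eq_zero_of_map_eq {A B : CompactTuple τ} {f : A.carrier → B.carrier} (hf : Isometry f)
    (sf : Function.Surjective f) (ho : f A.origin = B.origin) (hs : τ.map f hf A.str = B.str) :
    dc A B = 0 := by
  refine nonpos_iff_eq_zero.1 (dc_le_of_embeddings hf isometry_id ?_ ?_ ?_)
  · simp [sf.range_eq]
  · simp [ho]
  · rw [hs, show τ.map id isometry_id B.str = B.str from τ.map_id B.str, edist_self]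

end Subtuples

/-! ### Sandwiches below boundedly-compact tuples and the triangle inequality -/

section Closeness

variable {τ : PosFunctor.{u, v}} {T : Truncation τ}

/-- The compact tuple given by the ball of radius `r`. -/
def Tuple.at (𝒳 : Tuple T) (r : ℝ≥0) : CompactTuple τ := (𝒳.ball r).toCompactTuple

theorem dist_at_le (𝒳 : Tuple T) (r : ℝ≥0) (x : (𝒳.at r).carrier) :
    dist x (𝒳.at r).origin ≤ r := x.2

theorem Tuple.at_le (𝒳 : Tuple T) {r s : ℝ≥0} (h : r ≤ s) :
    (𝒳.ball r).carrier ≤ (𝒳.ball s).carrier :=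
  Metric.closedBall_subset_closedBall (NNReal.coe_le_coe.2 h)

theorem Tuple.sand_at (𝒳 : Tuple T) {r s : ℝ≥0} (h : r ≤ s) :
    Sand r (𝒳.at r) (𝒳.at s) (incl (𝒳.at_le h)) :=
  sand_of_trunc T (isometry_incl _) rfl (𝒳.str.compat _ _ _).symm
    fun y hy => ⟨⟨y.1, hy⟩, rfl⟩

/-- `A` lies, up to isomorphism, between the ball of radius `r` of `𝒳` and `𝒳`. -/
def TSand (r : ℝ≥0) (A : CompactTuple τ) (𝒳 : Tuple T) : Prop :=
  ∃ R, r ≤ R ∧ ∃ f, Sand r A (𝒳.at R) f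

theorem tsand_at (𝒳 : Tuple T) (r : ℝ≥0) : TSand r (𝒳.at r) 𝒳 :=
  ⟨r, le_rfl, id, sand_id r _⟩

theorem TSand.mono {r s : ℝ≥0} {A : CompactTuple τ} {𝒳 : Tuple T} (h : TSand r A 𝒳) (hs : s ≤ r) :
    TSand s A 𝒳 := by
  obtain ⟨R, hR, f, hf⟩ := h
  exact ⟨R, hs.trans hR, f, hf.mono hs⟩

theorem TSand.comp {r : ℝ≥0} {A B : CompactTuple τ} {𝒳 : Tuple T} {f : A.carrier → B.carrier}
    (h : TSand r B 𝒳) (hf : Sand r A B f) : TSand r A 𝒳 := by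
  obtain ⟨R, hR, g, hg⟩ := h
  exact ⟨R, hR, g ∘ f, hg.comp hf⟩

/-- A tuple sandwiched below `𝒳` embeds into every ball of `𝒳` that is large enough. -/
theorem TSand.exists_sand {r R : ℝ≥0} {A : CompactTuple τ} {𝒳 : Tuple T} (h : TSand r A 𝒳)
    (hA : ∀ x, dist x A.origin ≤ R) : ∃ f, Sand r A (𝒳.at R) f := by
  obtain ⟨R₀, hR₀, f, hf⟩ := h
  have h1 : Sand R₀ (𝒳.at R₀) (𝒳.at (max R₀ R)) _ := 𝒳.sand_at (le_max_left _ _)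
  have h2 : Sand R (𝒳.at R) (𝒳.at (max R₀ R)) _ := 𝒳.sand_at (le_max_right _ _)
  -- Inside the common ball of radius `max R₀ R`, the image of `A` stays within distance `R` of the
  -- origin, so it factors through the ball of radius `R`.
  obtain ⟨g, hg, eg⟩ := h2.2 A _ (h1.1.comp hf.1) fun x => by
    rw [(h1.1.comp hf.1).dist_origin]
    exact hA x
  exact ⟨g, ((h1.mono hR₀).comp hf).of_comp h2.1 hg eg⟩

theorem TSand.of_sand {r R : ℝ≥0} {A : CompactTuple τ} {𝒳 : Tuple T}
    {f : A.carrier → (𝒳.at R).carrier} (h : Sand r A (𝒳.at R) f) (hr : r ≤ R) : TSand r A 𝒳 :=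
  ⟨R, hr, f, h⟩

/-- The range of an isometric embedding of a compact space. -/
def rangeCompacts {X Y : Type u} [MetricSpace X] [CompactSpace X] [MetricSpace Y] {f : X → Y}
    (hf : Isometry f) : Compacts Y :=
  ⟨Set.range f, isCompact_range hf.continuous⟩

/-- An isometric embedding, as a map to its range. -/
def toRange {X Y : Type u} [MetricSpace X] [CompactSpace X] [MetricSpace Y] {f : X → Y}
    (hf : Isometry f) : X → rangeCompacts hf :=
  fun x => ⟨f x, x, rfl⟩

theorem isometry_toRange {X Y : Type u} [MetricSpace X] [CompactSpace X] [MetricSpace Y]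
    {f : X → Y} (hf : Isometry f) : Isometry (toRange hf) :=
  fun x y => hf x y

/-- The piece of `𝒳` given by an isometric embedding of a compact tuple. -/
def imagePiece (A : CompactTuple τ) {𝒳 : Tuple T} {f : A.carrier → 𝒳.carrier} (hf : Isometry f)
    (ho : f A.origin = 𝒳.origin) : Piece 𝒳 where
  carrier := rangeCompacts hf
  origin_mem := ⟨A.origin, ho⟩
  str := τ.map (toRange hf) (isometry_toRange hf) A.str

theorem dc_imagePiece (A : CompactTuple τ) {𝒳 : Tuple T} {f : A.carrier → 𝒳.carrier}
    (hf : Isometry f) (ho : f A.origin = 𝒳.origin) :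
    dc A (imagePiece A hf ho).toCompactTuple = 0 := by
  refine dc_eq_zero_of_map_eq (B := (imagePiece A hf ho).toCompactTuple)
    (isometry_toRange hf) ?_ (Subtype.ext ho) rfl
  rintro ⟨_, x, rfl⟩
  exact ⟨x, rfl⟩

theorem imagePiece_below {A : CompactTuple τ} {𝒳 : Tuple T} {R : ℝ≥0}
    {f : A.carrier → (𝒳.at R).carrier} (hf : IsSub A (𝒳.at R) f) (hf' : Isometry fun x => (f x).1)
    (ho : (f A.origin).1 = 𝒳.origin) : (imagePiece A hf' ho).Below := by
  have hle : rangeCompacts hf' ≤ (𝒳.ball R).carrier := by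
    rintro _ ⟨x, rfl⟩
    exact (f x).2
  change (imagePiece A hf' ho).str ≤ 𝒳.str.val (rangeCompacts hf')
  rw [← 𝒳.str.compat _ _ hle]
  refine (T.map_le_iff (isometry_incl hle)).1 (le_of_eq_of_le ?_ hf.le)
  exact map_map_of_comp_eq (isometry_toRange hf') (isometry_incl hle) hf.isom (fun _ => rfl) A.str

theorem ball_le_imagePiece {A : CompactTuple τ} {𝒳 : Tuple T} {r : ℝ≥0} {f : A.carrier → 𝒳.carrier}
    (hf : Isometry f) (ho : f A.origin = 𝒳.origin) {g : (𝒳.at r).carrier → A.carrier}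
    (hg : IsSub (𝒳.at r) A g) (e : ∀ x, f (g x) = x.1) : (𝒳.ball r).Le (imagePiece A hf ho) := by
  have hle : (𝒳.ball r).carrier ≤ rangeCompacts hf := fun x hx => ⟨g ⟨x, hx⟩, e ⟨x, hx⟩⟩
  refine ⟨hle, ?_⟩
  refine (T.map_le_iff (isometry_incl hle)).1
    (le_of_eq_of_le ?_ (τ.monotone_map (toRange hf) (isometry_toRange hf) hg.le))
  exact (map_map_of_comp_eq hg.isom (isometry_toRange hf) (isometry_incl hle)
    (fun x => Subtype.ext (e x)) (𝒳.at r).str).symm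

/-- The pieces between the ball of radius `r` of `𝒳` and `𝒳` are sandwiched tuples. -/
theorem Piece.tsand {𝒳 : Tuple T} {r : ℝ≥0} {P : Piece 𝒳} (h : (𝒳.ball r).Le P) (hP : P.Below) :
    TSand r P.toCompactTuple 𝒳 := by
  obtain ⟨R, hR⟩ := P.carrier.isCompact.isBounded.subset_closedBall 𝒳.origin
  have hle : P.carrier ≤ (𝒳.ball (max r R.toNNReal)).carrier := fun x hx =>
    (hR hx).trans ((Real.le_coe_toNNReal R).trans (NNReal.coe_le_coe.2 (le_max_right _ _)))
  have hsub : IsSub P.toCompactTuple (𝒳.at (max r R.toNNReal)) (incl hle) := by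
    refine ⟨isometry_incl hle, rfl, (T.map_le_iff (isometry_incl hle)).2 (le_of_le_of_eq hP ?_)⟩
    exact (𝒳.str.compat _ _ hle).symm
  obtain ⟨h1, h2⟩ := h
  have hb : IsSub (𝒳.at r) P.toCompactTuple (incl h1) :=
    ⟨isometry_incl h1, rfl, (T.map_le_iff (isometry_incl h1)).2 h2⟩
  refine ⟨_, le_max_left _ _, incl hle, hsub, fun D k hk hx => ?_⟩
  obtain ⟨l, hl, el⟩ := (𝒳.sand_at (le_max_left r R.toNNReal)).2 D k hk hx
  exact ⟨incl h1 ∘ l, hb.comp hl, fun x => el x⟩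

/-- `a_ε(𝒳, 𝒴)` in terms of sandwiched tuples. -/
theorem aFun_lt_iff {ε : ℝ≥0} {𝒳 𝒴 : Tuple T} {c : ℝ≥0∞} :
    aFun ε 𝒳 𝒴 < c ↔ ∃ A, TSand (ε⁻¹ - ε) A 𝒴 ∧ dc (𝒳.at ε⁻¹) A < c := by
  simp only [aFun, iInf_lt_iff]
  constructor
  · rintro ⟨P, h1, h2, h⟩
    exact ⟨_, Piece.tsand h1 h2, h⟩
  · rintro ⟨A, ⟨R, hR, f, hf⟩, h⟩
    -- The ball to be contained in the piece is itself a test tuple for the sandwich property.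
    obtain ⟨g, hg, eg⟩ := hf.2 (𝒴.at (ε⁻¹ - ε)) _ (𝒴.sand_at hR).1 (dist_at_le 𝒴 (ε⁻¹ - ε))
    have hf' : Isometry fun x => (f x).1 := hf.1.isom
    have ho : (f A.origin).1 = 𝒴.origin := congrArg Subtype.val hf.1.origin
    refine ⟨imagePiece A hf' ho, ball_le_imagePiece hf' ho hg fun x => congrArg Subtype.val (eg x),
      imagePiece_below hf.1 hf' ho, ?_⟩
    refine lt_of_le_of_lt ((dc_triangle _ A _).trans (le_of_eq ?_)) h
    rw [dc_imagePiece, add_zero]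
    rfl

/-- The subset property, in terms of embeddings. -/
theorem Truncation.SubsetProperty.exists_isSub (hT : T.SubsetProperty) {A B A' : CompactTuple τ}
    {f : A'.carrier → A.carrier} (hf : IsSub A' A f) :
    ∃ (B' : CompactTuple τ) (g : B'.carrier → B.carrier), IsSub B' B g ∧ dc A' B' ≤ dc A B := by
  let P : Piece (A.toTuple T) := imagePiece A' hf.isom hf.origin
  have hP : P.Below := by
    refine (T.map_le_iff isometry_subtype_coe).1 (le_of_eq_of_le ?_ hf.le)
    exact map_map_of_comp_eq (isometry_toRange hf.isom) isometry_subtype_coe hf.isom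
      (fun _ => rfl) A'.str
  obtain ⟨Q, hQ, hd⟩ := hT A B P hP
  refine ⟨Q.toCompactTuple, Subtype.val, ⟨isometry_subtype_coe, rfl,
    (T.map_le_iff isometry_subtype_coe).2 hQ⟩, ?_⟩
  refine (dc_triangle A' P.toCompactTuple _).trans ?_
  rw [show dc A' P.toCompactTuple = 0 from dc_imagePiece A' _ _, zero_add]
  exact hd

theorem sand_toTuple_at (A : CompactTuple τ) (r : ℝ≥0) :
    Sand r ((A.toTuple T).at r) A Subtype.val :=
  sand_of_trunc T isometry_subtype_coe rfl rfl fun y hy => ⟨⟨y, hy⟩, rfl⟩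

/-- The subset property for tuples containing a ball, in terms of embeddings. -/
theorem Truncation.BallSubsetProperty.exists_sand (hT : T.BallSubsetProperty)
    {A B A' : CompactTuple τ} {f : A'.carrier → A.carrier} {r ε : ℝ≥0} (hf : Sand r A' A f)
    (hd : dc A B ≤ ε) (hr : 2 * ε ≤ r) :
    ∃ (B' : CompactTuple τ) (g : B'.carrier → B.carrier), Sand (r - 2 * ε) B' B g ∧
      dc A' B' ≤ ε := by
  -- `T.BallSubsetProperty` takes the exact value of `dc A B`, which is finite here; replacing it by
  -- the bound `ε` only shrinks the radius of the resulting sandwich.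
  obtain ⟨e, he⟩ : ∃ e : ℝ≥0, (e : ℝ≥0∞) = dc A B :=
    ⟨_, ENNReal.coe_toNNReal (ne_top_of_le_ne_top ENNReal.coe_ne_top hd)⟩
  have hee : e ≤ ε := by rwa [← he, ENNReal.coe_le_coe] at hd
  let P : Piece (A.toTuple T) := imagePiece A' hf.1.isom hf.1.origin
  have hP : P.Below := by
    refine (T.map_le_iff isometry_subtype_coe).1 (le_of_eq_of_le ?_ hf.1.le)
    exact map_map_of_comp_eq (isometry_toRange hf.1.isom) isometry_subtype_coe hf.1.isom
      (fun _ => rfl) A'.str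
  obtain ⟨h, hh, eh⟩ := hf.2 ((A.toTuple T).at r) Subtype.val (sand_toTuple_at A r).1 fun x => x.2
  obtain ⟨Q, hQ1, hQ2, hQ⟩ := hT A B P r e he.symm ((mul_le_mul_right hee 2).trans hr)
    (ball_le_imagePiece hf.1.isom hf.1.origin hh eh) hP
  have hsub : IsSub Q.toCompactTuple B Subtype.val :=
    ⟨isometry_subtype_coe, rfl, (T.map_le_iff isometry_subtype_coe).2 hQ2⟩
  have hsand : Sand (r - 2 * e) Q.toCompactTuple B Subtype.val := by
    obtain ⟨h1, h2⟩ := hQ1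
    have hb : IsSub ((B.toTuple T).at (r - 2 * e)) Q.toCompactTuple (incl h1) :=
      ⟨isometry_incl h1, rfl, (T.map_le_iff (isometry_incl h1)).2 h2⟩
    refine ⟨hsub, fun D k hk hx => ?_⟩
    obtain ⟨l, hl, el⟩ := (sand_toTuple_at (T := T) B (r - 2 * e)).2 D k hk hx
    exact ⟨incl h1 ∘ l, hb.comp hl, fun x => el x⟩
  refine ⟨Q.toCompactTuple, Subtype.val, hsand.mono ?_, ?_⟩
  · exact tsub_le_tsub_left (mul_le_mul_right hee 2) r
  · refine (dc_triangle A' P.toCompactTuple _).trans ?_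
    rw [show dc A' P.toCompactTuple = 0 from dc_imagePiece A' _ _, zero_add]
    exact hQ.trans hd

/-- `𝒳` and `𝒴` are `ε`-close, in the asymmetric sense given by `a_ε(𝒳, 𝒴)`. -/
def Close (ε : ℝ≥0) (𝒳 𝒴 : Tuple T) : Prop := aFun ε 𝒳 𝒴 < (ε : ℝ≥0∞) / 2

/-- The ball subset property costs `2 * η` in the radius; the bound `ε / 2` on `d^c` keeps this
below `ε`. -/
theorem lt_half_of_lt {x : ℝ≥0∞} {ε : ℝ≥0} (h : x < (ε : ℝ≥0∞) / 2) :
    ∃ η : ℝ≥0, x = η ∧ 2 * η < ε := by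
  obtain ⟨η, hη⟩ : ∃ η : ℝ≥0, (η : ℝ≥0∞) = x := ⟨_, ENNReal.coe_toNNReal h.ne_top⟩
  refine ⟨η, hη.symm, ?_⟩
  rw [← hη, show (ε : ℝ≥0∞) / 2 = ((ε / 2 : ℝ≥0) : ℝ≥0∞) by simp, ENNReal.coe_lt_coe] at h
  rw [← NNReal.coe_lt_coe] at h ⊢
  push_cast at h ⊢
  linarith

/-- A tuple sandwiched below `𝒳` is close to a tuple sandwiched below `𝒴`, if `𝒴` is close
to `𝒳`. -/
theorem Close.exists_tsand (hT : T.BallSubsetProperty) {δ s t : ℝ≥0} {𝒳 𝒴 : Tuple T}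
    (h : Close δ 𝒳 𝒴) {A : CompactTuple τ} (hA : TSand s A 𝒳)
    (hb : ∀ x, dist x A.origin ≤ (δ⁻¹ : ℝ≥0)) (h1 : t + δ ≤ s) (h2 : t + δ ≤ δ⁻¹) :
    ∃ A', TSand t A' 𝒴 ∧ dc A A' < (δ : ℝ≥0∞) / 2 := by
  obtain ⟨B, ⟨R, hR, g, hg⟩, hd⟩ := aFun_lt_iff.1 h
  obtain ⟨η, hη, hηδ⟩ := lt_half_of_lt hd
  obtain ⟨f, hf⟩ := hA.exists_sand hb
  have hδs : δ ≤ s := le_trans le_add_self h1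
  obtain ⟨A', k, hk, hd'⟩ := hT.exists_sand hf hη.le (hηδ.le.trans hδs)
  -- Two constraints on the radius: the transport from `A` to `A'` lowers `s` by `2 * η`, and `B`
  -- itself is only guaranteed to contain the ball of radius `δ⁻¹ - δ` of `𝒴`.
  have ht1 : t ≤ s - 2 * η :=
    le_tsub_of_add_le_right ((add_le_add le_rfl hηδ.le).trans h1)
  have ht2 : t ≤ δ⁻¹ - δ := le_tsub_of_add_le_right h2
  refine ⟨A', TSand.of_sand ((hg.mono ht2).comp (hk.mono ht1)) (ht2.trans hR), ?_⟩
  rw [← hη] at hd'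
  exact hd'.trans_lt hd

/-- The ball of radius `(ε + δ)⁻¹` of `𝒳` is transported to `𝒴`, losing `ε` in the radius, and then
to `𝒵`, losing `δ`. The values of `d^c` add up to less than `(ε + δ) / 2`. -/
theorem Close.triangle (hT : T.BallSubsetProperty) {ε δ : ℝ≥0} {𝒳 𝒴 𝒵 : Tuple T} (hε : 0 < ε)
    (hδ : 0 < δ) (h1 : ε + δ ≤ 1) (h : Close ε 𝒳 𝒴) (h' : Close δ 𝒴 𝒵) :
    Close (ε + δ) 𝒳 𝒵 := by
  have hκ : 1 ≤ (ε + δ)⁻¹ := (one_le_inv₀ (by positivity)).2 h1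
  have e1 : (ε + δ)⁻¹ ≤ ε⁻¹ := inv_anti₀ hε le_self_add
  -- The intermediate tuple may have radius `(ε + δ)⁻¹ + ε` and must fit into the ball of radius
  -- `δ⁻¹`. It does, because the gap `ε / (δ (ε + δ))` is at least `ε` when `ε + δ ≤ 1`.
  have e2 : (ε + δ)⁻¹ + ε ≤ δ⁻¹ := by
    rw [← NNReal.coe_le_coe] at h1 ⊢
    rw [← NNReal.coe_pos] at hε hδ
    push_cast at h1 ⊢
    have : (δ : ℝ)⁻¹ - (ε + δ : ℝ)⁻¹ = ε * (1 / (δ * (ε + δ))) := by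
      field_simp
      ring
    have h3 : (1 : ℝ) ≤ 1 / (δ * (ε + δ)) := by
      rw [le_div_iff₀ (by positivity)]
      nlinarith
    nlinarith
  have e3 : ε + δ ≤ (ε + δ)⁻¹ := h1.trans hκ
  have e4 : ε ≤ (ε + δ)⁻¹ := le_self_add.trans e3
  obtain ⟨A, hA, hdA⟩ := h.exists_tsand hT (s := (ε + δ)⁻¹) (t := (ε + δ)⁻¹ - ε)
    (tsand_at 𝒳 (ε + δ)⁻¹)
    (fun x => (dist_at_le _ _ x).trans (NNReal.coe_le_coe.2 e1))
    (tsub_add_cancel_of_le e4).le ((tsub_add_cancel_of_le e4).le.trans e1)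
  have e5 : (ε + δ)⁻¹ - (ε + δ) + δ ≤ (ε + δ)⁻¹ - ε := by
    refine le_tsub_of_add_le_right ?_
    rw [add_assoc, add_comm δ ε, tsub_add_cancel_of_le e3]
  obtain ⟨B, hB, hdB⟩ := h'.exists_tsand hT (t := (ε + δ)⁻¹ - (ε + δ)) hA
    (fun x => (dist_origin_le_of_dc_lt hdA (dist_at_le _ _) x).trans
      (by exact_mod_cast e2)) e5 (e5.trans (tsub_le_self.trans (le_self_add.trans e2)))
  refine aFun_lt_iff.2 ⟨B, hB, (dc_triangle _ A _).trans_lt ?_⟩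
  rw [ENNReal.coe_add, ENNReal.add_div]
  exact ENNReal.add_lt_add hdA hdB

theorem close_self {ε : ℝ≥0} (hε : 0 < ε) (𝒳 : Tuple T) : Close ε 𝒳 𝒳 := by
  refine aFun_lt_iff.2 ⟨𝒳.at ε⁻¹, (tsand_at 𝒳 _).mono tsub_le_self, ?_⟩
  rw [dc_self]
  exact ENNReal.half_pos (by simpa using hε.ne')

/-- Both the ball of `𝒳` and the competitors below `𝒴` change with `ε`, so this is not formal. It is
the triangle inequality for `δ = ε + (δ - ε)` with `𝒴` close to itself. -/
theorem Close.mono (hT : T.BallSubsetProperty) {ε δ : ℝ≥0} {𝒳 𝒴 : Tuple T} (hε : 0 < ε)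
    (h : ε ≤ δ) (h1 : δ ≤ 1) (hc : Close ε 𝒳 𝒴) : Close δ 𝒳 𝒴 := by
  rcases h.eq_or_lt with rfl | hlt
  · exact hc
  · have := Close.triangle hT hε (tsub_pos_of_lt hlt) (by rwa [add_tsub_cancel_of_le h]) hc
      (close_self (tsub_pos_of_lt hlt) 𝒴)
    rwa [add_tsub_cancel_of_le h] at this

/-- Tuples are close if there are close compact tuples sandwiched below them that contain large
balls. -/
theorem close_of_tsand (hT : T.BallSubsetProperty) {r ε : ℝ≥0} {𝒳 𝒴 : Tuple T}
    {A B : CompactTuple τ} (hε : 0 < ε) (h1 : ε ≤ 1) (hA : TSand r A 𝒳) (hB : TSand r B 𝒴)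
    (hd : dc A B < (ε : ℝ≥0∞) / 2) (hr : ε⁻¹ ≤ r) : Close ε 𝒳 𝒴 := by
  obtain ⟨η, hη, hηε⟩ := lt_half_of_lt hd
  obtain ⟨R, hR, f, hf⟩ := hA
  -- The ball of radius `ε⁻¹` of `𝒳` is sandwiched in `A`, so the ball subset property for `A` and
  -- `B` applies to it.
  have hX := 𝒳.sand_at (hr.trans hR)
  obtain ⟨g, hg, eg⟩ := hf.2 _ _ hX.1 fun x => by
    rw [hX.1.dist_origin]
    exact (dist_at_le _ _ x).trans (NNReal.coe_le_coe.2 hr)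
  have hε1 : ε ≤ ε⁻¹ := h1.trans ((one_le_inv₀ hε).2 h1)
  obtain ⟨B', k, hk, hd'⟩ := hT.exists_sand (hX.of_comp hf.1 hg eg) hη.le (hηε.le.trans hε1)
  refine aFun_lt_iff.2 ⟨B', (hB.mono ?_).comp (hk.mono (tsub_le_tsub_left hηε.le _)),
    lt_of_le_of_lt ?_ hd⟩
  · exact tsub_le_self.trans hr
  · rw [hη]
    exact hd'

/-- `Close`, symmetrized. -/
def MutuallyClose (ε : ℝ≥0) (𝒳 𝒴 : Tuple T) : Prop := Close ε 𝒳 𝒴 ∧ Close ε 𝒴 𝒳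

theorem MutuallyClose.triangle (hT : T.BallSubsetProperty) {ε δ : ℝ≥0} {𝒳 𝒴 𝒵 : Tuple T}
    (hε : 0 < ε) (hδ : 0 < δ) (h1 : ε + δ ≤ 1) (h : MutuallyClose ε 𝒳 𝒴)
    (h' : MutuallyClose δ 𝒴 𝒵) : MutuallyClose (ε + δ) 𝒳 𝒵 := by
  refine ⟨h.1.triangle hT hε hδ h1 h'.1, ?_⟩
  have := h'.2.triangle hT hδ hε (by rwa [add_comm]) h.2
  rwa [add_comm] at this

theorem mutuallyClose_of_tsand (hT : T.BallSubsetProperty) {r ε : ℝ≥0} {𝒳 𝒴 : Tuple T}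
    {A B : CompactTuple τ} (hε : 0 < ε) (h1 : ε ≤ 1) (hA : TSand r A 𝒳) (hB : TSand r B 𝒴)
    (hd : dc A B < (ε : ℝ≥0∞) / 2) (hr : ε⁻¹ ≤ r) : MutuallyClose ε 𝒳 𝒴 :=
  ⟨close_of_tsand hT hε h1 hA hB hd hr, close_of_tsand hT hε h1 hB hA (by rwa [dc_comm]) hr⟩

theorem MutuallyClose.dist_le {ε : ℝ≥0} {𝒳 𝒴 : Tuple T} (hε : 0 < ε) (h1 : ε ≤ 1)
    (h : MutuallyClose ε 𝒳 𝒴) : 𝒳.dist 𝒴 ≤ ε :=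
  csInf_le (OrderBot.bddBelow _) (Or.inr ⟨hε, h1, max_lt h.1 h.2⟩)

theorem mutuallyClose_of_dist_lt (hT : T.BallSubsetProperty) {ε : ℝ≥0} {𝒳 𝒴 : Tuple T}
    (h1 : ε ≤ 1) (h : 𝒳.dist 𝒴 < ε) : MutuallyClose ε 𝒳 𝒴 := by
  obtain ⟨δ, hδ, hlt⟩ := exists_lt_of_csInf_lt (Set.insert_nonempty _ _) h
  rcases hδ with rfl | ⟨h0, hδ1, hm⟩
  -- The value `1` inserted into the set is never below `ε ≤ 1`.
  · exact absurd hlt (not_lt.2 h1)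
  · exact ⟨Close.mono hT h0 hlt.le h1 (max_lt_iff.1 hm).1,
      Close.mono hT h0 hlt.le h1 (max_lt_iff.1 hm).2⟩

end Closeness

/-! ### Limits of compact tuples and of sandwiches -/

section Limits

variable {τ : PosFunctor.{u, v}} {T : Truncation τ}

theorem inv_two_pow_eq_ofReal (n : ℕ) :
    (2⁻¹ : ℝ≥0∞) ^ n = ENNReal.ofReal ((1 / 2 : ℝ) ^ n) := by
  rw [ENNReal.ofReal_pow (by norm_num), one_div, ENNReal.ofReal_inv_of_pos (by norm_num)]
  simp

theorem dist_lt_of_edist_lt_inv_two_pow {X : Type*} [MetricSpace X] {x y : X} {n : ℕ}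
    (h : edist x y < (2⁻¹ : ℝ≥0∞) ^ n) : dist x y < (1 / 2 : ℝ) ^ n := by
  rwa [inv_two_pow_eq_ofReal, edist_lt_ofReal] at h

theorem tendsto_inv_two_pow : Tendsto (fun n => (2⁻¹ : ℝ≥0∞) ^ n) atTop (𝓝 0) :=
  ENNReal.tendsto_pow_atTop_nhds_zero_of_lt_one (by simp)

/-- The embeddings realizing a bound on `d^c(A, B)`, with an ambient space that is covered by the
two images. -/
theorem exists_covering_embeddings_of_dc_lt {A B : CompactTuple τ} {c : ℝ≥0∞} (h : dc A B < c) :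
    ∃ (Z : Type u) (_ : MetricSpace Z) (_ : CompactSpace Z) (f : A.carrier → Z) (hf : Isometry f)
      (g : B.carrier → Z) (hg : Isometry g),
      Metric.hausdorffEDist (Set.range f) (Set.range g) < c ∧
      edist (f A.origin) (g B.origin) < c ∧
      edist (τ.map f hf A.str) (τ.map g hg B.str) < c ∧
      ∀ z, z ∈ Set.range f ∨ z ∈ Set.range g := by
  obtain ⟨Z, _, _, f, hf, g, hg, h1, h2, h3⟩ := exists_embeddings_of_dc_lt h
  obtain ⟨W, i1, i2, f', g', i, hf', hg', hi, ef, eg, hcov⟩ := exists_compact_corestrict hf hg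
  refine ⟨W, i1, i2, f', hf', g', hg', ?_, ?_, ?_, hcov⟩
  · rw [← Metric.hausdorffEDist_image hi, ← Set.range_comp, ← Set.range_comp,
      show i ∘ f' = f from funext ef, show i ∘ g' = g from funext eg]
    exact h1
  · rw [← hi.edist_eq, ef, eg]
    exact h2
  · rw [edist_map_map_of_comp_eq hf' hg' hi hf hg ef eg]
    exact h3

/-- If `A` is close to a tuple below `B`, then `A` and `B` have a common extension in which `A` is
close to a part of `B`. -/
theorem exists_embeddings_of_isSub {A B Q : CompactTuple τ} {j : Q.carrier → B.carrier}
    (hj : IsSub Q B j) {c : ℝ≥0∞} (h : dc Q A < c) :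
    ∃ (W : Type u) (_ : MetricSpace W) (_ : CompactSpace W) (f : A.carrier → W) (hf : Isometry f)
      (g : B.carrier → W) (hg : Isometry g) (b : τ.obj B.carrier), b ≤ B.str ∧
      edist (τ.map f hf A.str) (τ.map g hg b) < c ∧ (∀ x, ∃ y, edist (f x) (g y) < c) ∧
      edist (f A.origin) (g B.origin) < c ∧ ∀ w, w ∈ Set.range f ∨ w ∈ Set.range g := by
  obtain ⟨Z, _, _, q, hq, a, ha, h1, h2, h3⟩ := exists_embeddings_of_dc_lt h
  -- Gluing along `Q` places `A` and `B` in one space, then cut down to their union; the structure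
  -- `b` is that of `Q` pushed into `B`.
  obtain ⟨G, _, _, k, l, hk, hl, hkl⟩ := exists_compact_glue hq hj.isom
  obtain ⟨W, i1, i2, f, g, i, hf, hg, hi, ef, eg, hcov⟩ :=
    exists_compact_corestrict (hk.comp ha) hl
  refine ⟨W, i1, i2, f, hf, g, hg, τ.map j hj.isom Q.str, hj.le, ?_, fun x => ?_, ?_, hcov⟩
  · rw [edist_map_map_of_comp_eq hf hg hi (hk.comp ha) hl ef eg,
      map_map_of_comp_eq hj.isom hl (hk.comp hq) (fun x => (hkl x).symm),
      ← edist_map_map_of_comp_eq ha hq hk (hk.comp ha) (hk.comp hq) (fun _ => rfl) (fun _ => rfl),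
      edist_comm]
    exact h3
  · rw [Metric.hausdorffEDist_comm] at h1
    obtain ⟨_, ⟨y, rfl⟩, hy⟩ :=
      Metric.exists_edist_lt_of_hausdorffEDist_lt (Set.mem_range_self x) h1
    refine ⟨j y, ?_⟩
    rw [← hi.edist_eq, ef, eg, ← hkl, Function.comp, hk.edist_eq]
    exact hy
  · rw [← hi.edist_eq, ef, eg, ← hj.origin, ← hkl, Function.comp, hk.edist_eq, edist_comm]
    exact h2

/-- If there are tuples below `B` arbitrarily close to `A`, then `A` embeds below `B`. -/
theorem exists_isSub_of_forall_dc_lt (hpc : τ.toMetricFunctor.PointwiseContinuous)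
    {A B : CompactTuple τ} (h : ∀ c > 0, ∃ Q j, IsSub Q B j ∧ dc Q A < c) :
    ∃ j, IsSub A B j := by
  choose Q j hj hQ using fun n : ℕ =>
    h ((2⁻¹ : ℝ≥0∞) ^ n) (by rw [inv_two_pow_eq_ofReal]; positivity)
  choose W i1 i2 f hf g hg b hb hfb hfg hfo hcov using fun n =>
    exists_embeddings_of_isSub (hj n) (hQ n)
  -- All ambient spaces are glued along `B`. The images of `A` approach the image of `B`, so a limit
  -- of the embeddings of `A` factors through `B`.
  obtain ⟨Z, _, _, G, k, hG, hk, hkG⟩ := exists_compact_star_glue hg fun n w => by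
    rcases hcov n w with ⟨x, rfl⟩ | ⟨y, rfl⟩
    · obtain ⟨y, hy⟩ := hfg n x
      exact ⟨y, (dist_lt_of_edist_lt_inv_two_pow hy).le⟩
    · exact ⟨y, by simp⟩
  obtain ⟨S, φ, hS, hφ, hlim⟩ :=
    exists_subseq_tendsto_isometry (fun n => k n ∘ f n) fun n => (hk n).comp (hf n)
  have hφ0 : Tendsto (fun n => (1 / 2 : ℝ) ^ φ n) atTop (𝓝 0) :=
    (tendsto_pow_atTop_nhds_zero_of_lt_one (by norm_num) (by norm_num)).comp hφ.tendsto_atTop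
  have hrange : ∀ x, S x ∈ Set.range G := by
    intro x
    choose y hy using fun n => hfg n x
    refine (isCompact_range hG.continuous).isClosed.mem_of_tendsto (f := fun n => G (y (φ n)))
      (b := atTop) ?_ (Eventually.of_forall fun n => ⟨_, rfl⟩)
    refine (hlim x).congr_dist ?_
    refine squeeze_zero (fun _ => dist_nonneg) (fun n => ?_) hφ0
    rw [← hkG, Function.comp, (hk _).dist_eq]
    exact (dist_lt_of_edist_lt_inv_two_pow (hy _)).le
  obtain ⟨e, he, hGe⟩ := exists_isometry_lift hG hS hrange
  have hSo : S A.origin = G B.origin := by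
    refine tendsto_nhds_unique ((hlim A.origin).congr_dist ?_) tendsto_const_nhds
    refine squeeze_zero (fun _ => dist_nonneg) (fun n => ?_) hφ0
    rw [← hkG, Function.comp, (hk _).dist_eq]
    exact (dist_lt_of_edist_lt_inv_two_pow (hfo _)).le
  refine ⟨e, he, hG.injective (by rw [hGe, hSo]), ?_⟩
  -- The structures `b n ≤ B.str` accumulate at some `b' ≤ B.str` by compactness of cones. Pointwise
  -- continuity identifies `b'` with the image of `A.str`.
  obtain ⟨b', hb', ψ, hψ, hbl⟩ :=
    (τ.isCompact_cone B.str).tendsto_subseq (x := fun n => b (φ n)) fun n => hb (φ n)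
  have hA := (hpc A.carrier Z S hS _ (fun n => (hk (φ n)).comp (hf (φ n))) hlim A.str).comp
    hψ.tendsto_atTop
  have hB := ((τ.isometry_map G hG).continuous.tendsto b').comp hbl
  have h0 : Tendsto (fun n => (2⁻¹ : ℝ≥0∞) ^ φ (ψ n)) atTop (𝓝 0) :=
    tendsto_inv_two_pow.comp (hφ.comp hψ).tendsto_atTop
  have hz := tendsto_nhds_unique (hA.edist hB) (tendsto_of_tendsto_of_tendsto_of_le_of_le
    tendsto_const_nhds h0 (fun _ => zero_le) fun n => by
      have h3 := (hfb (φ (ψ n))).le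
      rw [edist_map_map_of_comp_eq (hf _) (hg _) (hk _) ((hk _).comp (hf _)) hG (fun _ => rfl)
        (hkG _)] at h3
      exact h3)
  rw [edist_eq_zero, ← map_map_of_comp_eq he hG hS hGe] at hz
  rw [(τ.isometry_map G hG).injective hz]
  exact hb'

/-- The limit of a sandwich is a sandwich, up to a slight decrease of the radius. -/
theorem exists_sand_of_forall_dc_lt (hrigid : τ.NoShrinking) (hsub : T.SubsetProperty)
    (hball : T.BallSubsetProperty) (hpc : τ.toMetricFunctor.PointwiseContinuous)
    {A B : CompactTuple τ} {r s : ℝ≥0} (hs : s < r)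
    (h : ∀ c > 0, ∃ A' B' f, Sand r A' B' f ∧ dc A' A < c ∧ dc B' B < c) :
    ∃ f, Sand s A B f := by
  obtain ⟨j, hj⟩ : ∃ j, IsSub A B j := by
    refine exists_isSub_of_forall_dc_lt hpc fun c hc => ?_
    obtain ⟨A', B', f, hf, hA, hB⟩ := h (c / 2) (ENNReal.half_pos hc.ne')
    obtain ⟨Q, g, hg, hQ⟩ := hsub.exists_isSub (B := B) hf.1
    refine ⟨Q, g, hg, (dc_triangle Q A' A).trans_lt ?_⟩
    rw [dc_comm, ← ENNReal.add_halves c]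
    exact ENNReal.add_lt_add (hQ.trans_lt hB) hA
  let D : CompactTuple τ := (B.toTuple T).at s
  have hD : Sand s D B Subtype.val := sand_toTuple_at B s
  have hDs : ∀ x : D.carrier, dist x D.origin ≤ s := dist_at_le (B.toTuple T) s
  -- The ball `D` of `B` is approximated by a tuple below `B'` that contains slightly less than the
  -- ball of radius `r`. The latter's counterpart is obtained the other way round: `A'` contains the
  -- ball of radius `r` of `B'`, so transport to `B` gives `Q` close to `A'` and still containing
  -- `D`; the part of `Q` given by `D` then moves on to `A`. The gap `r - s` absorbs the loss of
  -- radius.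
  obtain ⟨i, hi⟩ : ∃ i, IsSub D A i := by
    refine exists_isSub_of_forall_dc_lt hpc fun c hc => ?_
    have hrs : 0 < r - s := tsub_pos_of_lt hs
    obtain ⟨A', B', f, hf, hA, hB⟩ := h (min (c / 2) (((r - s : ℝ≥0) : ℝ≥0∞) / 2))
      (lt_min (ENNReal.half_pos hc.ne') (ENNReal.half_pos (ENNReal.coe_pos.2 hrs).ne'))
    obtain ⟨η, hη, hηrs⟩ := lt_half_of_lt (hB.trans_le (min_le_right _ _))
    obtain ⟨Q, g, hg, hQ⟩ := hball.exists_sand hf hη.le (hηrs.le.trans tsub_le_self)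
    have hsη : s ≤ r - 2 * η :=
      le_tsub_of_add_le_left ((add_le_add hηrs.le le_rfl).trans (tsub_add_cancel_of_le hs.le).le)
    obtain ⟨l, hl, -⟩ := (hg.mono hsη).2 D _ hD.1 fun x => x.2
    obtain ⟨R, m, hm, hR⟩ := hsub.exists_isSub (B := A) hl
    refine ⟨R, m, hm, ?_⟩
    rw [dc_comm]
    refine hR.trans_lt ((dc_triangle Q A' A).trans_lt ?_)
    rw [dc_comm, ← ENNReal.add_halves c]
    rw [← hη] at hQ
    exact ENNReal.add_lt_add (hQ.trans_lt (hB.trans_le (min_le_left _ _)))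
      (hA.trans_le (min_le_left _ _))
  -- The composite `D → A → B` lands in `D` again. It is onto by compactness and shrinks the
  -- structure, hence preserves it by rigidity. Its inverse corrects `i` into a partial section of
  -- `j`.
  obtain ⟨e, he, hje⟩ := hD.2 D _ (hj.comp hi) fun x => by
    rw [(hj.comp hi).dist_origin]
    exact hDs x
  let E : D.carrier ≃ᵢ D.carrier :=
    ⟨Equiv.ofBijective e ⟨he.isom.injective, surjective_of_isometry he.isom⟩, he.isom⟩
  have hE : τ.map e he.isom D.str = D.str := hrigid D.carrier E D.str he.le
  have hsymm : IsSub D D E.symm := by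
    refine ⟨E.symm.isometry, ?_, ?_⟩
    · exact (E.symm_apply_eq).2 he.origin.symm
    · conv_lhs => rw [← hE]
      exact (map_map_eq_self he.isom E.symm.isometry (fun x => E.symm_apply_apply x) D.str).le
  refine ⟨j, hj, fun F k hk hb => ?_⟩
  obtain ⟨l, hl, hlk⟩ := hD.2 F k hk hb
  refine ⟨i ∘ E.symm ∘ l, hi.comp (hsymm.comp hl), fun x => ?_⟩
  rw [← hlk x]
  refine (hje (E.symm (l x))).symm.trans (congrArg Subtype.val ?_)
  exact E.apply_symm_apply (l x)

/-- If the values of `τ` are complete, then compact tuples form a complete space. -/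
theorem exists_tendsto_dc (himage : τ.toMetricFunctor.ImageClosed)
    (hcomp : ∀ (X : Type u) [MetricSpace X] [CompactSpace X], CompleteSpace (τ.obj X))
    (A : ℕ → CompactTuple τ) (hA : ∀ n, dc (A n) (A (n + 1)) < 2⁻¹ ^ n) :
    ∃ B, Tendsto (fun n => dc (A n) B) atTop (𝓝 0) := by
  choose W i1 i2 l hl r hr h1 h2 h3 hcov using fun n => exists_covering_embeddings_of_dc_lt (hA n)
  obtain ⟨Z, _, _, k, hk, hkr⟩ := exists_compact_glue_seq hl hr fun n w => by
    rcases hcov n w with ⟨x, rfl⟩ | ⟨y, rfl⟩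
    · exact ⟨x, by simp⟩
    · have h := h1 n
      rw [Metric.hausdorffEDist_comm] at h
      obtain ⟨_, ⟨x, rfl⟩, hx⟩ :=
        Metric.exists_edist_lt_of_hausdorffEDist_lt (Set.mem_range_self y) h
      exact ⟨x, (dist_lt_of_edist_lt_inv_two_pow hx).le⟩
  let p : ∀ n, (A n).carrier → Z := fun n => k n ∘ l n
  have hp : ∀ n, Isometry (p n) := fun n => (hk n).comp (hl n)
  have er : ∀ n, k n ∘ r n = p (n + 1) := fun n => funext (hkr n)
  have b1 : ∀ n, Metric.hausdorffEDist (Set.range (p n)) (Set.range (p (n + 1))) ≤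
      1 * 2⁻¹ ^ n := fun n => by
    rw [← er, one_mul, Set.range_comp, Set.range_comp, Metric.hausdorffEDist_image (hk n)]
    exact (h1 n).le
  have b2 : ∀ n, edist (p n (A n).origin) (p (n + 1) (A (n + 1)).origin) ≤ 1 * 2⁻¹ ^ n :=
      fun n => by
    rw [← er, one_mul]
    exact ((hk n).edist_eq _ _).trans_le (h2 n).le
  have b3 : ∀ n, edist (τ.map (p n) (hp n) (A n).str)
      (τ.map (p (n + 1)) (hp (n + 1)) (A (n + 1)).str) ≤ 1 * 2⁻¹ ^ n := fun n => by
    rw [one_mul, ← edist_map_map_of_comp_eq (hl n) (hr n) (hk n) (hp n) (hp (n + 1)) (fun _ => rfl)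
      (hkr n)]
    exact (h3 n).le
  have two : (2⁻¹ : ℝ≥0∞) < 1 := by simp
  have := hcomp Z
  obtain ⟨o, ho⟩ := cauchySeq_tendsto_of_complete
    (cauchySeq_of_edist_le_geometric _ _ two ENNReal.one_ne_top b2)
  obtain ⟨b, hb⟩ := cauchySeq_tendsto_of_complete
    (cauchySeq_of_edist_le_geometric _ _ two ENNReal.one_ne_top b3)
  -- The images converge in the complete space of nonempty compact subsets of `Z`; `himage` then
  -- pulls the limit structure back to the limit set.
  let K : ℕ → NonemptyCompacts Z := fun n =>
    ⟨⟨Set.range (p n), isCompact_range (hp n).continuous⟩, Set.range_nonempty _⟩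
  obtain ⟨L, hL⟩ := cauchySeq_tendsto_of_complete
    (cauchySeq_of_edist_le_geometric (f := K) _ _ two ENNReal.one_ne_top b1)
  have hL0 : Tendsto (fun n => Metric.hausdorffEDist (Set.range (p n)) (L : Set Z)) atTop (𝓝 0) :=
    tendsto_iff_edist_tendsto_0.1 hL
  have hoL : o ∈ L.toCompacts := by
    refine (Metric.mem_iff_infEDist_zero_of_closed L.isCompact.isClosed).2 ?_
    refine tendsto_nhds_unique ((Metric.continuous_infEDist.tendsto o).comp ho)
      (tendsto_of_tendsto_of_tendsto_of_le_of_le tendsto_const_nhds hL0 (fun _ => zero_le)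
        fun n => ?_)
    exact Metric.infEDist_le_hausdorffEDist_of_mem (Set.mem_range_self _)
  have hval : Isometry (Subtype.val : L.toCompacts → Z) := isometry_subtype_coe
  have hrange : Set.range (Subtype.val : L.toCompacts → Z) = L := Subtype.range_coe
  obtain ⟨a, ha⟩ := himage Z L.toCompacts (fun n => (A n).carrier) Subtype.val hval p hp
    (by rw [hrange]; exact hL0) b _ hb
  refine ⟨⟨L.toCompacts, ⟨o, hoL⟩, a⟩, ?_⟩
  have ho0 := tendsto_iff_edist_tendsto_0.1 ho
  have hb0 := tendsto_iff_edist_tendsto_0.1 hb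
  have hmax := hL0.max (ho0.max hb0)
  simp only [max_self] at hmax
  refine tendsto_of_tendsto_of_tendsto_of_le_of_le tendsto_const_nhds hmax (fun _ => zero_le)
    fun n => ?_
  refine dc_le_of_embeddings (hp n) hval ?_ ?_ ?_
  · rw [hrange]
    exact le_max_left _ _
  · exact (le_max_left _ _).trans (le_max_right _ _)
  · rw [ha]
    exact (le_max_right _ _).trans (le_max_right _ _)

end Limits

/-! ### Direct limits of tuples and completeness -/

section Completeness

variable {τ : PosFunctor.{u, v}} {T : Truncation τ}

/-- The limit of an increasing sequence of spaces. -/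
theorem exists_directLimit {X : ℕ → Type u} [∀ n, MetricSpace (X n)] {f : ∀ n, X n → X (n + 1)}
    (hf : ∀ n, Isometry (f n)) :
    ∃ (Z : Type u) (_ : MetricSpace Z) (i : ∀ n, X n → Z), (∀ n, Isometry (i n)) ∧
      (∀ n x, i (n + 1) (f n x) = i n x) ∧ ∀ z, ∃ n x, i n x = z := by
  refine ⟨Metric.InductiveLimit hf, inferInstance, Metric.toInductiveLimit hf,
    Metric.toInductiveLimit_isometry hf,
    fun n x => congrFun (Metric.toInductiveLimit_commute hf n) x, ?_⟩
  rintro ⟨n, x⟩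
  exact ⟨n, x, rfl⟩

theorem CompactTuple.exists_bound (A : CompactTuple τ) :
    ∃ R : ℝ≥0, ∀ x : A.carrier, dist x A.origin ≤ R := by
  obtain ⟨R, hR⟩ := (isCompact_univ (X := A.carrier)).isBounded.subset_closedBall A.origin
  exact ⟨R.toNNReal, fun x => (hR (Set.mem_univ x)).trans (Real.le_coe_toNNReal R)⟩

/-- An increasing sequence of compact tuples, each of which contains a large ball of the next,
has a limit. -/
theorem exists_tuple_of_sand {A : ℕ → CompactTuple τ} {f : ∀ k, (A k).carrier → (A (k + 1)).carrier}
    {ρ : ℕ → ℝ≥0} (hρ : Monotone ρ) (hρ' : ∀ R, ∃ k, R ≤ ρ k)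
    (hf : ∀ k, Sand (ρ k) (A k) (A (k + 1)) (f k)) : ∃ 𝒳 : Tuple T, ∀ k, TSand (ρ k) (A k) 𝒳 := by
  obtain ⟨X, _, i, hi, hif, hsurj⟩ := exists_directLimit fun k => (hf k).1.isom
  have hcomp : ∀ k m, k ≤ m → ∃ g : (A k).carrier → (A m).carrier,
      Sand (ρ k) (A k) (A m) g ∧ ∀ x, i m (g x) = i k x := by
    intro k m hkm
    induction m, hkm using Nat.le_induction with
    | base => exact ⟨id, sand_id _ _, fun _ => rfl⟩
    | succ m hkm ih =>
      obtain ⟨g, hg, eg⟩ := ih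
      exact ⟨f m ∘ g, ((hf m).mono (hρ hkm)).comp hg, fun x => (hif m (g x)).trans (eg x)⟩
  let o : X := i 0 (A 0).origin
  have ho : ∀ k, i k (A k).origin = o := fun k => by
    obtain ⟨g, hg, eg⟩ := hcomp 0 k (Nat.zero_le k)
    rw [← hg.1.origin, eg]
  have hdist : ∀ k x, dist (i k x) o = dist x (A k).origin := fun k x => by
    rw [← ho k, (hi k).dist_eq]
  -- The ball of radius `ρ k` is already complete at stage `k`: at any later stage it is a test
  -- tuple that factors through `A k`. This also makes `X` proper.
  have hrange : ∀ k x, dist x o ≤ ρ k → x ∈ Set.range (i k) := by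
    intro k x hx
    obtain ⟨m, y, rfl⟩ := hsurj x
    rcases le_total m k with hmk | hkm
    · obtain ⟨g, -, eg⟩ := hcomp m k hmk
      exact ⟨g y, eg y⟩
    · obtain ⟨g, hg, eg⟩ := hcomp k m hkm
      obtain ⟨h, -, eh⟩ := hg.2 (((A m).toTuple T).at (ρ k)) _ (sand_toTuple_at (A m) (ρ k)).1
        fun x => x.2
      rw [hdist] at hx
      exact ⟨h ⟨y, hx⟩, (eg _).symm.trans (congrArg (i m) (eh ⟨y, hx⟩))⟩
  -- Stages agree on spaces within both of their radii, so the structure put on a compact `K` below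
  -- does not depend on the stage `κ K`, and the family is compatible.
  have htrunc : ∀ (K : Type u) [MetricSpace K] [CompactSpace K] (k m : ℕ) (p : K → (A k).carrier)
      (hp : Isometry p) (q : K → (A m).carrier) (hq : Isometry q), (∀ x, i k (p x) = i m (q x)) →
      (∀ x, dist (i k (p x)) o ≤ ρ k) → (∀ x, dist (i m (q x)) o ≤ ρ m) →
      T.trunc p hp (A k).str = T.trunc q hq (A m).str := by
    have key : ∀ (K : Type u) [MetricSpace K] [CompactSpace K] (k m : ℕ), k ≤ m →
        ∀ (p : K → (A k).carrier) (hp : Isometry p) (q : K → (A m).carrier) (hq : Isometry q),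
        (∀ x, i k (p x) = i m (q x)) → (∀ x, dist (i k (p x)) o ≤ ρ k) →
        T.trunc p hp (A k).str = T.trunc q hq (A m).str := by
      intro K _ _ k m hkm p hp q hq e hb
      obtain ⟨g, hg, eg⟩ := hcomp k m hkm
      refine hg.trunc_eq T hp hq (fun x => (hi m).injective ?_) fun x => ?_
      · rw [eg, e]
      · rw [← hdist]
        exact hb x
    intro K _ _ k m p hp q hq e hb hb'
    rcases le_total k m with h | h
    · exact key K k m h p hp q hq e hb
    · exact (key K m k h q hq p hp (fun x => (e x).symm) hb').symm
  have hproper : ProperSpace X := by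
    refine ProperSpace.of_seq_closedBall (l := atTop) (x := o) (r := fun k => (ρ k : ℝ)) ?_
      (Eventually.of_forall fun k => ?_)
    · refine tendsto_atTop_atTop_of_monotone (fun _ _ h => NNReal.coe_le_coe.2 (hρ h)) fun b => ?_
      obtain ⟨k, hk⟩ := hρ' b.toNNReal
      exact ⟨k, (Real.le_coe_toNNReal b).trans (NNReal.coe_le_coe.2 hk)⟩
    · exact (isCompact_range (hi k).continuous).of_isClosed_subset Metric.isClosed_closedBall
        fun x hx => hrange k x hx
  have hK : ∀ K : Compacts X, ∃ k, ∀ x : K, dist x.1 o ≤ ρ k := fun K => by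
    obtain ⟨R, hR⟩ := K.isCompact.isBounded.subset_closedBall o
    obtain ⟨k, hk⟩ := hρ' R.toNNReal
    exact ⟨k, fun x => (hR x.2).trans
      ((Real.le_coe_toNNReal R).trans (NNReal.coe_le_coe.2 hk))⟩
  choose κ hκ using hK
  have hlift : ∀ K : Compacts X, ∃ e : K → (A (κ K)).carrier, Isometry e ∧
      ∀ x, i (κ K) (e x) = x.1 := fun K =>
    exists_isometry_lift (hi (κ K)) isometry_subtype_coe fun x => hrange _ _ (hκ K x)
  choose e he hie using hlift
  let 𝒳 : Tuple T :=
    { carrier := X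
      origin := o
      str :=
        { val := fun K => T.trunc (e K) (he K) (A (κ K)).str
          compat := fun K L h => by
            rw [trunc_trunc_of_comp_eq T (isometry_incl h) (he L)
              ((he L).comp (isometry_incl h)) fun _ => rfl]
            have h1 : ∀ x, i (κ L) (e L (incl h x)) = x.1 := fun x => hie L (incl h x)
            refine htrunc K _ _ _ _ _ _ (fun x => (h1 x).trans (hie K x).symm) (fun x => ?_)
              fun x => ?_
            · rw [Function.comp, h1]
              exact hκ L (incl h x)
            · rw [hie]
              exact hκ K x } }
  refine ⟨𝒳, fun k => ?_⟩
  obtain ⟨R₀, hR₀⟩ := (A k).exists_bound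
  -- `R` bounds `A k`, and the stage `m` is late enough to contain the ball of radius `R` of `𝒳`;
  -- hence `A k` factors through that ball.
  obtain ⟨m₀, hm₀⟩ := hρ' (max (ρ k) R₀)
  have hm : max (ρ k) R₀ ≤ ρ (max k m₀) := hm₀.trans (hρ (le_max_right _ _))
  set m := max k m₀
  set R := max (ρ k) R₀
  obtain ⟨g, hg, eg⟩ := hcomp k m (le_max_left _ _)
  obtain ⟨l, hl, il⟩ := exists_isometry_lift (hi m)
    (g := (Subtype.val : (𝒳.at R).carrier → X)) isometry_subtype_coe fun x =>
      hrange m _ (le_trans x.2 (NNReal.coe_le_coe.2 hm))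
  have hsand : Sand R (𝒳.at R) (A m) l := by
    refine sand_of_trunc T hl ((hi m).injective ?_) ?_ fun y hy => ?_
    · exact (il _).trans (ho m).symm
    · refine htrunc (𝒳.at R).carrier _ _ _ _ _ _ (fun x => ?_) (fun x => ?_) fun x => ?_
      · exact (hie _ x).trans (il x).symm
      · refine le_of_eq_of_le ?_ (hκ (cball o R) x)
        exact congrArg (dist · o) (hie _ x)
      · exact le_of_eq_of_le (congrArg (dist · o) (il x))
          (le_trans x.2 (NNReal.coe_le_coe.2 hm))
    · rw [← hdist] at hy
      refine ⟨⟨i m y, hy⟩, (hi m).injective (il _)⟩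
  obtain ⟨p, hp, lp⟩ := hsand.2 (A k) g hg.1 fun x => by
    rw [hg.1.dist_origin]
    exact (hR₀ x).trans (NNReal.coe_le_coe.2 (le_max_right _ _))
  exact ⟨R, le_max_left _ _, p, hg.of_comp hsand.1 hp lp⟩

theorem exists_seq_of_step {α : Type*} {P : ℕ → α → Prop} {Q : ℕ → α → α → Prop}
    (h0 : ∃ a, P 0 a) (hs : ∀ m a, P m a → ∃ a', P (m + 1) a' ∧ Q m a a') :
    ∃ s : ℕ → α, ∀ m, P m (s m) ∧ Q m (s m) (s (m + 1)) := by
  obtain ⟨a, ha⟩ := h0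
  choose! next hP hQ using hs
  let s : ℕ → α := fun m => Nat.rec a next m
  have hsP : ∀ m, P m (s m) := fun m => by
    induction m with
    | zero => exact ha
    | succ m ih => exact hP m _ ih
  exact ⟨s, fun m => ⟨hsP m, hQ m _ (hsP m)⟩⟩

theorem half_inv_two_pow_le (k m : ℕ) :
    ((((2 : ℝ≥0)⁻¹ ^ (k + m) : ℝ≥0)) : ℝ≥0∞) / 2 ≤ 2⁻¹ ^ m := by
  rw [ENNReal.coe_pow, ENNReal.coe_inv two_ne_zero, ENNReal.coe_ofNat, div_eq_mul_inv, ← pow_succ]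
  exact pow_le_pow_of_le_one zero_le (by simp) (by omega)

/-- The balls of a rapidly Cauchy sequence of tuples are close to a convergent sequence of compact
tuples. -/
theorem exists_seq_tsand (hball : T.BallSubsetProperty) {Y : ℕ → Tuple T}
    (hY : ∀ k, Close (2⁻¹ ^ (k + 3)) (Y k) (Y (k + 1))) (k : ℕ) :
    ∃ A : ℕ → CompactTuple τ, ∀ m, (TSand (2 ^ (k + 3) - 2) (A m) (Y (k + m)) ∧
      ∀ x, dist x (A m).origin ≤ ((2 ^ (k + 3) : ℝ≥0) : ℝ)) ∧ dc (A m) (A (m + 1)) < 2⁻¹ ^ m := by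
  have hk2 : (2 : ℝ≥0) ≤ 2 ^ (k + 3) := by
    calc (2 : ℝ≥0) = 2 ^ 1 := (pow_one _).symm
      _ ≤ 2 ^ (k + 3) := pow_le_pow_right₀ one_le_two (by omega)
  -- The term `2 * 2⁻¹ ^ (k + m + 3)` is the sum of all errors from step `m` on. Each step lowers
  -- the sandwich radius and raises the size by at most its own error, so both bounds persist. As
  -- the total is at most `1`, the ball of radius `2 ^ (k + 3) - 1` can start the sequence.
  let P : ℕ → CompactTuple τ → Prop := fun m A =>
    TSand (2 ^ (k + 3) - 2 + 2 * 2⁻¹ ^ (k + m + 3)) A (Y (k + m)) ∧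
      ∀ x, dist x A.origin + 2 * 2⁻¹ ^ (k + m + 3) ≤ 2 ^ (k + 3)
  have hsmall : ∀ m, 2 * (2⁻¹ : ℝ≥0) ^ (k + m + 3) ≤ 1 := fun m => by
    rw [pow_succ', ← mul_assoc, mul_inv_cancel₀ two_ne_zero, one_mul]
    exact pow_le_one₀ zero_le (inv_le_one_of_one_le₀ one_le_two)
  have hdouble : ∀ m, 2 * (2⁻¹ : ℝ≥0) ^ (k + (m + 1) + 3) = 2⁻¹ ^ (k + m + 3) := fun m => by
    rw [show k + (m + 1) + 3 = k + m + 3 + 1 by omega, pow_succ', ← mul_assoc,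
      mul_inv_cancel₀ two_ne_zero, one_mul]
  have hle : ∀ m, 2 ^ (k + 3) - 2 + 2 * 2⁻¹ ^ (k + m + 3) ≤ (2 ^ (k + 3) - 1 : ℝ≥0) := fun m => by
    refine (add_le_add le_rfl (hsmall m)).trans (le_of_eq ?_)
    rw [← NNReal.coe_inj]
    push_cast [NNReal.coe_sub hk2, NNReal.coe_sub (one_le_two.trans hk2)]
    ring
  obtain ⟨A, hA⟩ := exists_seq_of_step (P := P)
    (Q := fun m A A' => dc A A' < (((2 : ℝ≥0)⁻¹ ^ (k + m + 3) : ℝ≥0) : ℝ≥0∞) / 2)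
    ⟨(Y k).at (2 ^ (k + 3) - 1), (tsand_at _ _).mono (hle 0), fun x => by
      have h1 := dist_at_le (Y k) _ x
      have h2 : (2 * 2⁻¹ ^ (k + 0 + 3) : ℝ) ≤ 1 := by exact_mod_cast hsmall 0
      rw [NNReal.coe_sub (one_le_two.trans hk2)] at h1
      push_cast at h1
      linarith⟩ fun m A hA => by
    have hb : ∀ x, dist x A.origin ≤ ((2⁻¹ ^ (k + m + 3) : ℝ≥0)⁻¹ : ℝ≥0) := fun x => by
      have h1 := hA.2 x
      have h2 : (0 : ℝ) ≤ 2 * 2⁻¹ ^ (k + m + 3) := by positivity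
      have h3 : (2 : ℝ) ^ (k + 3) ≤ 2 ^ (k + m + 3) :=
        pow_le_pow_right₀ one_le_two (by omega)
      rw [inv_pow, inv_inv]
      push_cast
      linarith
    have ht : 2 ^ (k + 3) - 2 + 2⁻¹ ^ (k + m + 3) + 2⁻¹ ^ (k + m + 3) =
        (2 ^ (k + 3) - 2 + 2 * 2⁻¹ ^ (k + m + 3) : ℝ≥0) := by
      rw [two_mul, add_assoc]
    obtain ⟨A', hA', hd⟩ := (hY (k + m)).exists_tsand hball
      (t := 2 ^ (k + 3) - 2 + 2⁻¹ ^ (k + m + 3)) hA.1 hb ht.le (by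
        rw [ht]
        refine (hle m).trans (tsub_le_self.trans ?_)
        rw [inv_pow, inv_inv]
        exact pow_le_pow_right₀ one_le_two (by omega))
    refine ⟨A', ⟨?_, fun x => ?_⟩, hd⟩
    · rw [hdouble]
      exact hA'
    · have h1 := dist_origin_le_of_dc_lt hd (fun y => le_sub_iff_add_le.2 (hA.2 y)) x
      have h2 := congrArg NNReal.toReal (hdouble m)
      push_cast at h1 h2
      rw [h2]
      linarith
  refine ⟨A, fun m => ⟨⟨(hA m).1.1.mono le_self_add, fun x => ?_⟩, ?_⟩⟩
  · have h1 := (hA m).1.2 x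
    have h2 : (0 : ℝ) ≤ 2 * 2⁻¹ ^ (k + m + 3) := by positivity
    push_cast
    linarith
  · have h := half_inv_two_pow_le (k + 3) m
    rw [show k + 3 + m = k + m + 3 by omega] at h
    exact (hA m).2.trans_le h

/-- Rapidly Cauchy sequences of tuples converge. -/
theorem exists_limit_of_close (hrigid : τ.NoShrinking) (hsub : T.SubsetProperty)
    (hball : T.BallSubsetProperty) (himage : τ.toMetricFunctor.ImageClosed)
    (hpc : τ.toMetricFunctor.PointwiseContinuous)
    (hcomp : ∀ (X : Type u) [MetricSpace X] [CompactSpace X], CompleteSpace (τ.obj X))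
    {Y : ℕ → Tuple T} (hY : ∀ k, Close (2⁻¹ ^ (k + 3)) (Y k) (Y (k + 1))) :
    ∃ 𝒳 : Tuple T, ∀ ε, 0 < ε → ε ≤ 1 → ∀ᶠ n in atTop, MutuallyClose ε (Y n) 𝒳 := by
  choose A hA using fun k => exists_seq_tsand hball hY k
  choose B hB using fun k => exists_tendsto_dc himage hcomp (A k) fun m => (hA k m).2
  have h3 : ∀ k, (8 : ℝ≥0) ≤ 2 ^ (k + 3) := fun k => by
    rw [pow_add]
    exact (le_of_eq (by norm_num)).trans (mul_le_mul_left (one_le_pow₀ one_le_two) _)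
  have hmono : Monotone fun k : ℕ => (2 ^ (k + 3) - 3 : ℝ≥0) := fun k l hkl =>
    tsub_le_tsub_right (pow_le_pow_right₀ one_le_two (by omega)) 3
  have hlt : ∀ k : ℕ, (2 ^ (k + 3) - 3 : ℝ≥0) < 2 ^ (k + 3) - 2 := fun k => by
    have h8 := h3 k
    rw [← NNReal.coe_lt_coe, NNReal.coe_sub (le_trans (by norm_num) h8),
      NNReal.coe_sub (le_trans (by norm_num) h8)]
    norm_num
  have hunb : ∀ R, ∃ k : ℕ, R ≤ (2 ^ (k + 3) - 3 : ℝ≥0) := fun R => by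
    obtain ⟨k, hk⟩ := pow_unbounded_of_one_lt (R + 3) (one_lt_two (α := ℝ≥0))
    exact ⟨k, le_tsub_of_add_le_right (hk.le.trans (pow_le_pow_right₀ one_le_two (by omega)))⟩
  -- Both tuples lie below `Y (k + m + 1)`, and the size `2 ^ (k + 3)` of the first is within the
  -- radius `2 ^ (k + 4) - 2` guaranteed for the second.
  have hsand : ∀ k m, ∃ f, Sand (2 ^ (k + 3) - 2) (A k (m + 1)) (A (k + 1) m) f := fun k m => by
    have h1 := (hA k (m + 1)).1
    have h2 := (hA (k + 1) m).1
    rw [show k + 1 + m = k + (m + 1) by omega] at h2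
    have hle : (2 : ℝ≥0) ^ (k + 3) ≤ 2 ^ (k + 1 + 3) - 2 := by
      refine le_tsub_of_add_le_right ?_
      rw [show k + 1 + 3 = k + 3 + 1 by omega, pow_succ _ (k + 3), mul_two]
      exact add_le_add le_rfl (le_trans (by norm_num : (2 : ℝ≥0) ≤ 8) (h3 k))
    obtain ⟨f, hf⟩ := h1.1.exists_sand (R := 2 ^ (k + 1 + 3)) fun x =>
      (h1.2 x).trans (NNReal.coe_le_coe.2 (hle.trans tsub_le_self))
    obtain ⟨g, hg⟩ := h2.1.exists_sand h2.2
    obtain ⟨l, hl, el⟩ := hg.2 _ f hf.1 fun x => by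
      rw [hf.1.dist_origin]
      exact (h1.2 x).trans (NNReal.coe_le_coe.2 hle)
    exact ⟨l, hf.of_comp hg.1 hl el⟩
  -- The unit of radius between `- 2` and `- 3` is spent on passing to the limit in `m`.
  have hlim : ∀ k, ∃ f, Sand (2 ^ (k + 3) - 3) (B k) (B (k + 1)) f := fun k => by
    refine exists_sand_of_forall_dc_lt hrigid hsub hball hpc (hlt k) fun c hc => ?_
    have e1 := ((hB k).comp (tendsto_add_atTop_nat 1)).eventually (gt_mem_nhds hc)
    obtain ⟨m, hm1, hm2⟩ := (e1.and ((hB (k + 1)).eventually (gt_mem_nhds hc))).exists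
    obtain ⟨f, hf⟩ := hsand k m
    exact ⟨_, _, f, hf, hm1, hm2⟩
  choose f hf using hlim
  obtain ⟨𝒳, h𝒳⟩ := exists_tuple_of_sand (T := T) hmono hunb hf
  refine ⟨𝒳, fun ε hε h1 => ?_⟩
  -- For a level `k` with radius beyond `ε⁻¹`, the tuples `A k m` below `Y (k + m)` approach `B k`
  -- below `𝒳`, so the closeness criterion applies.
  obtain ⟨k, hk⟩ := hunb ε⁻¹
  have e1 := (hB k).eventually
    (gt_mem_nhds (ENNReal.half_pos (ENNReal.coe_pos.2 hε).ne'))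
  obtain ⟨N, hN⟩ := eventually_atTop.1 e1
  refine eventually_atTop.2 ⟨k + N, fun n hn => ?_⟩
  obtain ⟨m, rfl⟩ := Nat.exists_eq_add_of_le hn
  rw [add_assoc]
  exact mutuallyClose_of_tsand hball hε h1 ((hA k (N + m)).1.1.mono (hlt k).le) (h𝒳 k)
    (hN _ le_self_add) hk

/-- A rapidly Cauchy subsequence has a limit, to which the whole sequence converges by the triangle
inequality. -/
theorem cauchyComplete_dist (hrigid : τ.NoShrinking) (hsub : T.SubsetProperty)
    (hball : T.BallSubsetProperty) (himage : τ.toMetricFunctor.ImageClosed)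
    (hpc : τ.toMetricFunctor.PointwiseContinuous)
    (hcomp : ∀ (X : Type u) [MetricSpace X] [CompactSpace X], CompleteSpace (τ.obj X)) :
    CauchyComplete (CPrime.dist T) := by
  intro x hx
  obtain ⟨Y, rfl⟩ : ∃ Y : ℕ → Tuple T, x = fun n => Quotient.mk (tupleSetoid T) (Y n) :=
    ⟨fun n => (x n).out, funext fun n => ((x n).out_eq).symm⟩
  have hclose : ∀ ε, 0 < ε → ε ≤ 1 → ∃ N, ∀ m ≥ N, ∀ n ≥ N, MutuallyClose ε (Y m) (Y n) :=
      fun ε hε h1 => by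
    obtain ⟨N, hN⟩ := hx ε hε
    exact ⟨N, fun m hm n hn => mutuallyClose_of_dist_lt hball h1 (hN m hm n hn)⟩
  obtain ⟨φ, hφ, hφc⟩ := extraction_forall_of_eventually' (P := fun k N => ∀ m ≥ N, ∀ n ≥ N,
      MutuallyClose (2⁻¹ ^ (k + 3)) (Y m) (Y n)) fun k => by
    obtain ⟨N, hN⟩ := hclose (2⁻¹ ^ (k + 3)) (by positivity)
      (pow_le_one₀ zero_le (inv_le_one_of_one_le₀ one_le_two))
    exact ⟨N, fun N' hN' m hm n hn => hN m (hN'.trans hm) n (hN'.trans hn)⟩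
  obtain ⟨𝒳, h𝒳⟩ := exists_limit_of_close (Y := fun k => Y (φ k)) hrigid hsub hball himage hpc hcomp
    fun k => (hφc k _ le_rfl _ (hφ.monotone k.le_succ)).1
  refine ⟨Quotient.mk (tupleSetoid T) 𝒳, fun ε hε => ?_⟩
  obtain ⟨δ, hδ, hδε, hδ1⟩ : ∃ δ : ℝ≥0, 0 < δ ∧ δ + δ < ε ∧ δ + δ ≤ 1 := by
    obtain ⟨a, ha, hae⟩ := exists_between (lt_min hε one_pos)
    refine ⟨a / 2, half_pos ha, ?_, ?_⟩
    · rw [add_halves]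
      exact hae.trans_le (min_le_left _ _)
    · rw [add_halves]
      exact (hae.trans_le (min_le_right _ _)).le
  have hδ1' : δ ≤ 1 := le_self_add.trans hδ1
  obtain ⟨N, hN⟩ := hclose δ hδ hδ1'
  obtain ⟨k, hk1, hk2⟩ :=
    ((h𝒳 δ hδ hδ1').and (hφ.tendsto_atTop.eventually (eventually_ge_atTop N))).exists
  refine ⟨N, fun n hn => lt_of_le_of_lt ?_ hδε⟩
  exact ((hN n hn _ hk2).triangle hball hδ hδ hδ1 hk1).dist_le (by positivity) hδ1

end Completeness

/-! ### Gromov-Hausdorff approximation and separability -/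

section Separability

variable {τ : PosFunctor.{u, v}} {T : Truncation τ}

/-- A sequence of compact spaces that is dense with respect to the Gromov-Hausdorff distance. -/
abbrev denseCompact (n : ℕ) : Type u :=
  ULift.{u} (denseSeq GromovHausdorff.GHSpace n).Rep

/-- The Gromov-Hausdorff distance is attained by embeddings into `ℓ^∞`; `ULift` brings this ambient
space into universe `u`. -/
theorem exists_embeddings_denseCompact (X : Type u) [MetricSpace X] [CompactSpace X] [Nonempty X]
    {δ : ℝ} (hδ : 0 < δ) :
    ∃ (n : ℕ) (W : Type u) (_ : MetricSpace W) (_ : CompactSpace W) (f : X → W)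
      (g : denseCompact.{u} n → W), Isometry f ∧ Isometry g ∧
      Metric.hausdorffEDist (Set.range f) (Set.range g) < ENNReal.ofReal δ ∧
      ∀ w, w ∈ Set.range f ∨ w ∈ Set.range g := by
  obtain ⟨n, hn⟩ := (denseRange_denseSeq GromovHausdorff.GHSpace).exists_dist_lt
    (GromovHausdorff.toGHSpace X) hδ
  rw [← GromovHausdorff.GHSpace.toGHSpace_rep (denseSeq GromovHausdorff.GHSpace n)] at hn
  obtain ⟨Φ, Ψ, hΦ, hΨ, hd⟩ := GromovHausdorff.ghDist_eq_hausdorffDist X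
    (denseSeq GromovHausdorff.GHSpace n).Rep
  replace hn : Metric.hausdorffDist (Set.range Φ) (Set.range Ψ) < δ := hd ▸ hn
  have hne : Metric.hausdorffEDist (Set.range Φ) (Set.range Ψ) ≠ ∞ :=
    Metric.hausdorffEDist_ne_top_of_nonempty_of_bounded (Set.range_nonempty _)
      (Set.range_nonempty _) (isCompact_range hΦ.continuous).isBounded
      (isCompact_range hΨ.continuous).isBounded
  replace hn := (ENNReal.lt_ofReal_iff_toReal_lt hne).2 hn
  have hup : Isometry (ULift.up.{u} : lp (fun _ : ℕ => ℝ) ∞ → _) := fun _ _ => rfl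
  have hdown : Isometry (ULift.down : denseCompact.{u} n → _) := fun _ _ => rfl
  obtain ⟨W, i1, i2, f, g, i, hf, hg, hi, ef, eg, hcov⟩ :=
    exists_compact_corestrict (hup.comp hΦ) ((hup.comp hΨ).comp hdown)
  refine ⟨n, W, i1, i2, f, g, hf, hg, ?_, hcov⟩
  rw [← Metric.hausdorffEDist_image hi, ← Set.range_comp, ← Set.range_comp,
    show i ∘ f = _ from funext ef, show i ∘ g = _ from funext eg,
    ULift.down_surjective.range_comp, Set.range_comp, Set.range_comp,
    Metric.hausdorffEDist_image hup]
  exact hn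

/-- Dense subsets of the spaces of structures on a dense sequence of compact spaces are dense in the
space of compact tuples. -/
theorem exists_dc_denseCompact_le (hh : τ.toMetricFunctor.HausdorffContinuous)
    {S : ∀ n, Set (denseCompact.{u} n × τ.obj (denseCompact.{u} n))} (hS : ∀ n, Dense (S n))
    (A : CompactTuple τ) {c : ℝ≥0∞} (hc : 0 < c) :
    ∃ n, ∃ p ∈ S n, dc A ⟨denseCompact.{u} n, p.1, p.2⟩ ≤ c := by
  choose n W i1 i2 f g hf hg hd hcov using fun k : ℕ =>
    exists_embeddings_denseCompact A.carrier (δ := (1 / 2 : ℝ) ^ k) (by positivity)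
  -- Hausdorff continuity concerns subspaces of one fixed compact space, so all approximations are
  -- first glued along `A`.
  obtain ⟨Z, _, _, G, h, hG, hh', hhG⟩ := exists_compact_star_glue hf fun k w => by
    rcases hcov k w with ⟨x, rfl⟩ | ⟨y, rfl⟩
    · exact ⟨x, by simp⟩
    · have h := hd k
      rw [Metric.hausdorffEDist_comm] at h
      obtain ⟨_, ⟨x, rfl⟩, hx⟩ :=
        Metric.exists_edist_lt_of_hausdorffEDist_lt (Set.mem_range_self y) h
      exact ⟨x, (edist_lt_ofReal.1 hx).le⟩
  have hs : ∀ k, Isometry (h k ∘ g k) := fun k => (hh' k).comp (hg k)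
  have hlim : Tendsto (fun k => Metric.hausdorffEDist (Set.range (h k ∘ g k)) (Set.range G)) atTop
      (𝓝 0) := by
    refine tendsto_of_tendsto_of_tendsto_of_le_of_le tendsto_const_nhds tendsto_inv_two_pow
      (fun _ => zero_le) fun k => ?_
    rw [← show h k ∘ f k = G from funext (hhG k), Set.range_comp, Set.range_comp,
      Metric.hausdorffEDist_image (hh' k), Metric.hausdorffEDist_comm, inv_two_pow_eq_ofReal]
    exact (hd k).le
  have hlim' := hh Z A.carrier (fun k => denseCompact.{u} (n k)) G hG _ hs hlim
  have hc2 := ENNReal.half_pos hc.ne'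
  obtain ⟨k, hk1, hk2⟩ := ((hlim.eventually (gt_mem_nhds hc2)).and
    (hlim'.eventually (gt_mem_nhds hc2))).exists
  rw [Metric.hausdorffEDist_comm] at hk1 hk2
  obtain ⟨_, ⟨x, rfl⟩, hx⟩ :=
    Metric.exists_edist_lt_of_hausdorffEDist_lt (Set.mem_range_self A.origin) hk1
  obtain ⟨_, ⟨t, rfl⟩, ht⟩ :=
    Metric.exists_edist_lt_of_hausdorffEDist_lt (Set.mem_range_self A.str) hk2
  obtain ⟨p, hp, hpx⟩ := EMetric.mem_closure_iff.1 (hS (n k) (x, t)) (c / 2) hc2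
  obtain ⟨hp1, hp2⟩ := max_lt_iff.1 hpx
  refine ⟨n k, p, hp, dc_le_of_embeddings (B := ⟨denseCompact.{u} (n k), p.1, p.2⟩) hG (hs k) ?_ ?_
    ?_⟩
  · exact hk1.le.trans ENNReal.half_le_self
  · refine (edist_triangle _ ((h k ∘ g k) x) _).trans ?_
    rw [(hs k).edist_eq, ← ENNReal.add_halves c]
    exact add_le_add hx.le hp1.le
  · refine (edist_triangle _ (τ.map _ (hs k) t) _).trans ?_
    rw [(τ.isometry_map _ (hs k)).edist_eq, ← ENNReal.add_halves c]
    exact add_le_add ht.le hp2.le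

/-- The space of `A` is bounded, so `A` is its own ball for every sufficiently large radius. -/
theorem tsand_toTuple (A : CompactTuple τ) (r : ℝ≥0) : TSand r A (A.toTuple T) := by
  obtain ⟨R, hR⟩ := A.exists_bound
  have hsand := sand_toTuple_at (T := T) A (max r R)
  obtain ⟨f, hf, ef⟩ := hsand.2 A id (isSub_id A) fun x =>
    (hR x).trans (NNReal.coe_le_coe.2 (le_max_right _ _))
  exact ⟨max r R, le_max_left _ _, f, (sand_id r A).of_comp hsand.1 hf ef⟩

/-- Only the ball of radius `δ⁻¹` of a tuple has to be approximated, and a compact tuple is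
sandwiched in itself for every radius. -/
theorem countablyDense_dist (hball : T.BallSubsetProperty)
    (hh : τ.toMetricFunctor.HausdorffContinuous)
    (hsep : ∀ (X : Type u) [MetricSpace X] [CompactSpace X], SeparableSpace (τ.obj X)) :
    CountablyDense (CPrime.dist T) := by
  have hS : ∀ n, ∃ S : Set (denseCompact.{u} n × τ.obj (denseCompact.{u} n)),
      S.Countable ∧ Dense S := fun n => by
    have := hsep (denseCompact.{u} n)
    exact exists_countable_dense _
  choose S hSc hSd using hS
  refine ⟨⋃ n, (fun p => Quotient.mk (tupleSetoid T)
    (CompactTuple.toTuple T ⟨denseCompact.{u} n, p.1, p.2⟩)) '' S n,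
    Set.countable_iUnion fun n => (hSc n).image _, fun x ε hε => ?_⟩
  obtain ⟨𝒳, rfl⟩ := Quotient.exists_rep (s := tupleSetoid T) x
  obtain ⟨δ, hδ, hδε⟩ := exists_between (lt_min hε one_pos)
  obtain ⟨c, hc, hcδ⟩ := exists_between (ENNReal.half_pos (ENNReal.coe_pos.2 hδ).ne')
  obtain ⟨n, p, hp, hd⟩ := exists_dc_denseCompact_le hh hSd (𝒳.at δ⁻¹) hc
  refine ⟨_, Set.mem_iUnion.2 ⟨n, p, hp, rfl⟩, ?_⟩
  have h1 : δ ≤ 1 := (hδε.trans_le (min_le_right _ _)).le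
  exact (mutuallyClose_of_tsand hball hδ h1 (tsand_at 𝒳 δ⁻¹) (tsand_toTuple _ _)
    (hd.trans_lt hcδ) le_rfl).dist_le hδ h1 |>.trans_lt (hδε.trans_le (min_le_left _ _))

end Separability

end GHF

theorem theorem4p7 (τ : GHF.PosFunctor.{u, v}) (T : GHF.Truncation τ)
    (hrigid : τ.NoShrinking)
    (hsub : T.SubsetProperty)
    (hball : T.BallSubsetProperty)
    (himage : τ.toMetricFunctor.ImageClosed)
    (hpointwise : τ.toMetricFunctor.PointwiseContinuous)
    (hhausdorff : τ.toMetricFunctor.HausdorffContinuous) :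
    ((∀ (X : Type u) [MetricSpace X] [CompactSpace X], CompleteSpace (τ.obj X)) →
        GHF.CauchyComplete (GHF.CPrime.dist T)) ∧
      ((∀ (X : Type u) [MetricSpace X] [CompactSpace X],
          TopologicalSpace.SeparableSpace (τ.obj X)) →
        GHF.CountablyDense (GHF.CPrime.dist T)) :=
  ⟨fun hcomp => GHF.cauchyComplete_dist hrigid hsub hball himage hpointwise hcomp,
    fun hsep => GHF.countablyDense_dist hball hhausdorff hsep⟩
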